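/- \textbf{Setting.} Let $(\mathcal X,\mathcal F,P)$ be a probability space, $P^*$ and $P_*$ the outer and inner probabilities, and $d\ge 0$. Let $\Theta\subset\mathbb R^d$, $\theta_0\in\Theta$, and for $n\ge 1$ let $L_n(\theta)$, $\theta\in\Theta$, be real random criterion functions, measurable in $\theta\in\Theta$ for each sample point and measurable in the sample point for each $\theta\in\Theta$. Let $\pi:\Theta\to\mathbb R_+$, $\rho:\mathbb R^d\to\mathbb R_+$, $\rho_n(u)=\rho(\sqrt n\,u)$, and $$p_n(\theta)=\frac{e^{L_n(\theta)}\pi(\theta)}{\int_\Theta e^{L_n(t)}\pi(t)\,dt},\qquad Q_n(\zeta)=\int_\Theta\rho_n(\theta-\zeta)\,p_n(\theta)\,d\theta .$$ The Laplace-type estimator is $\hat\theta\in\arg\min_{\zeta\in\Theta}Q_n(\zeta)$. \textbf{Assumptions.} (1) $\Theta$ is compact and convex, and $\theta_0\in\operatorname{int}\Theta$. (2) $\rho\ge 0$; $\rho(u)=0$ iff $u=0$; $\rho$ is convex; $\rho(h)\le 1+|h|^p$ for some $p\ge 1$; for every symmetric positive definite $a$ the function $\xi\mapsto\int_{\mathbb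 R^d}\rho(u-\xi)e^{-u'au}\,du$ has a unique minimizer in $\mathbb R^d$; $\pi$ is a probability density on $\Theta$ which is continuous and bounded below by a positive constant. (3) For every $\delta>0$ there is $\epsilon>0$ with $$\liminf_{n\to\infty}P_*\Big\{\sup_{\theta\in\Theta,\ |\theta-\theta_0|\ge\delta}\tfrac1n\big(L_n(\theta)-L_n(\theta_0)\big)\le-\epsilon\Big\}=1 .$$ (4) There are random vectors $\Delta_n\in\mathbb R^d$ and nonrandom symmetric $d\times d$ matrices $J_n,\Omega_n$, $n\ge1$, bounded and positive definite uniformly in $n$, such that $\Omega_n^{-1/2}\Delta_n/\sqrt n\to_d N(0,I)$, and the remainder $R_n$ defined by $$L_n(\theta)-L_n(\theta_0)=(\theta-\theta_0)'\Delta_n-\tfrac12(\theta-\theta_0)'[nJ_n](\theta-\theta_0)+R_n(\theta)$$ satisfies: for each $\epsilon>0$ there are $\delta>0$ and $M>0$ with (suprema over $\theta\in\Theta$) $$\limsup_n P^*\Big\{\sup_{M/\sqrt n\le|\theta-\theta_0|\le\delta}\frac{|R_n(\theta)|}{n|\theta-\theta_0|^2}>\epsilon\Big\}<\epsilon,\qquad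 \limsup_n P^*\Big\{\sup_{|\theta-\theta_0|\le M/\sqrt n}|R_n(\theta)|>\epsilon\Big\}=0 .$$ \textbf{Theorem (LTE in large samples).} Let $U_n=J_n^{-1}\Delta_n/\sqrt n$, and let $\xi_{J_n}$ be the minimizer over $z\in\mathbb R^d$ of $\int_{\mathbb R^d}\rho(u-z)\,p_{J_n}(u)\,du$, where $p_J(u)=\sqrt{\det J/(2\pi)^d}\;e^{-u'Ju/2}$ (with the number $2\pi$, not the weight) is the $N(0,J^{-1})$ density. Under the assumptions above $$\sqrt n(\hat\theta-\theta_0)=\xi_{J_n}+U_n+o_p(1),\qquad \Omega_n^{-1/2}J_nU_n\to_d N(0,I),$$ and hence $$\Omega_n^{-1/2}J_n\big(\sqrt n(\hat\theta-\theta_0)-\xi_{J_n}\big)\to_d N(0,I).$$ If $\rho_n(h)=\rho_n(-h)$ for all $h$ and $n$, then $\xi_{J_n}=0$ for each $n\ge1$, and $\hat\theta$ is asymptotically equivalent to the extremum estimator: $\sqrt n(\hat\theta-\hat\theta_{ex})=o_p(1)$ for every $\hat\theta_{ex}\in\arg\max_{\theta\in\Theta}L_n(\theta)$. (The estimators need not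 be measurable; $o_p(1)$ is in outer probability and $\to_d$ for $\hat\theta$ is in the sense of Hoffmann-Jørgensen, through outer expectations of bounded continuous functions, which is the usual notion for measurable maps.) -/

import Mathlib

open MeasureTheory ProbabilityTheory Filter Topology
open scoped ENNReal BoundedContinuousFunction

noncomputable section

namespace LTE

/-! ### Outer probability, outer expectation and convergence in distribution

A measure `P` of Mathlib, evaluated at a set which need not be measurable, is the outer measure,
that is, the outer probability `P^*`. In particular `TendstoInMeasure` is convergence in outer
probability when it is applied to maps which need not be measurable. -/

/-- Inner probability `P_*(A) = 1 - P^*(Aᶜ)`. -/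
def innerProb {Ω : Type*} [MeasurableSpace Ω] (P : Measure Ω) (A : Set Ω) : ℝ≥0∞ :=
  1 - P Aᶜ

/-- Outer expectation of a bounded, not necessarily measurable function `T`: the infimum of `∫ g`
over all integrable measurable `g ≥ T`. -/
def outerExpectation {Ω : Type*} [MeasurableSpace Ω] (P : Measure Ω) (T : Ω → ℝ) : ℝ :=
  sInf {m : ℝ | ∃ g : Ω → ℝ, Measurable g ∧ Integrable g P ∧ (∀ ω, T ω ≤ g ω) ∧ m = ∫ ω, g ω ∂P}

/-- Convergence in distribution of a sequence of not necessarily measurable maps `X n` to the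
Borel probability measure `ν`: the outer expectation of `f (X n)` tends to `∫ f dν`
for every bounded continuous `f` (Hoffmann-Jørgensen). For measurable `X n` this is the usual
convergence in distribution, see `tendstoInLaw_iff`. -/
def TendstoInLaw {Ω E : Type*} [MeasurableSpace Ω] [TopologicalSpace E] [MeasurableSpace E]
    (P : Measure Ω) (X : ℕ → Ω → E) (ν : Measure E) : Prop :=
  ∀ f : E →ᵇ ℝ,
    Tendsto (fun n => outerExpectation P (fun ω => f (X n ω))) atTop (𝓝 (∫ x, f x ∂ν))

theorem outerExpectation_eq_integral {Ω : Type*} [MeasurableSpace Ω] {P : Measure Ω}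
    [IsProbabilityMeasure P] {T : Ω → ℝ} (hT : AEMeasurable T P) {C : ℝ} (hC : ∀ ω, |T ω| ≤ C) :
    outerExpectation P T = ∫ ω, T ω ∂P := by
  have hTi : Integrable T P :=
    Integrable.of_bound hT.aestronglyMeasurable C (Eventually.of_forall hC)
  have hlb : ∀ m ∈ {m : ℝ | ∃ g : Ω → ℝ, Measurable g ∧ Integrable g P ∧ (∀ ω, T ω ≤ g ω) ∧
      m = ∫ ω, g ω ∂P}, ∫ ω, T ω ∂P ≤ m := by
    rintro m ⟨g, -, hgi, hg, rfl⟩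
    exact integral_mono hTi hgi hg
  refine IsLeast.csInf_eq ⟨?_, hlb⟩
  classical
  set N : Set Ω := toMeasurable P {ω | T ω ≠ hT.mk T ω} with hN
  have hNm : MeasurableSet N := measurableSet_toMeasurable _ _
  have hN0 : P N = 0 := by
    rw [hN, measure_toMeasurable]; exact hT.ae_eq_mk
  have hgm : Measurable (N.piecewise (fun _ => C) (hT.mk T)) :=
    Measurable.piecewise hNm measurable_const hT.measurable_mk
  have hae : T =ᵐ[P] N.piecewise (fun _ => C) (hT.mk T) := by
    have h1 : ∀ᵐ ω ∂P, ω ∉ N := measure_eq_zero_iff_ae_notMem.1 hN0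
    filter_upwards [h1, hT.ae_eq_mk] with ω h1 h2
    rw [Set.piecewise_eq_of_notMem _ _ _ h1, h2]
  refine ⟨_, hgm, hTi.congr hae, fun ω => ?_, integral_congr_ae hae⟩
  by_cases h : ω ∈ N
  · rw [Set.piecewise_eq_of_mem _ _ _ h]; exact (abs_le.1 (hC ω)).2
  · rw [Set.piecewise_eq_of_notMem _ _ _ h]
    have : ω ∉ {ω | T ω ≠ hT.mk T ω} := fun h' => h (subset_toMeasurable _ _ h')
    exact (not_not.1 this).le

/-- For measurable maps, `TendstoInLaw` is Mathlib's convergence in distribution. -/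
theorem tendstoInLaw_iff {Ω E : Type*} [MeasurableSpace Ω] [TopologicalSpace E]
    [MeasurableSpace E] [OpensMeasurableSpace E] {P : Measure Ω} [IsProbabilityMeasure P]
    {X : ℕ → Ω → E} (hX : ∀ n, AEMeasurable (X n) P) (ν : Measure E) [IsProbabilityMeasure ν] :
    TendstoInLaw P X ν ↔ TendstoInDistribution X atTop (id : E → E) (fun _ => P) ν := by
  have key : ∀ (f : E →ᵇ ℝ) (n : ℕ),
      outerExpectation P (fun ω => f (X n ω)) = ∫ x, f x ∂(P.map (X n)) := by
    intro f n
    have hf : AEMeasurable (fun ω => f (X n ω)) P :=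
      f.continuous.measurable.comp_aemeasurable (hX n)
    rw [outerExpectation_eq_integral (C := ‖f‖) hf (fun ω => f.norm_coe_le_norm _),
      integral_map (hX n) f.continuous.measurable.aestronglyMeasurable]
  constructor
  · intro h
    refine ⟨hX, aemeasurable_id, ProbabilityMeasure.tendsto_iff_forall_integral_tendsto.2 ?_⟩
    intro f
    have := h f
    simp only [key] at this
    simpa using this
  · intro h f
    have := (ProbabilityMeasure.tendsto_iff_forall_integral_tendsto.1 h.tendsto) f
    simp only [key]
    simpa using this

/-! ### Quasi-posterior and Laplace-type estimators -/

/-- The scaled loss function `ρ_n(u) = ρ(√n u)`. -/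
def scaledLoss {d : ℕ} (ρ : EuclideanSpace ℝ (Fin d) → ℝ) (n : ℕ)
    (u : EuclideanSpace ℝ (Fin d)) : ℝ :=
  ρ (√(n : ℝ) • u)

/-- The quasi-posterior density
`p_n(θ) = e^{L_n(θ)} π(θ) / ∫_Θ e^{L_n(t)} π(t) dt`, where `ℓ = L_n`. -/
def quasiPosterior {d : ℕ} (Θ : Set (EuclideanSpace ℝ (Fin d)))
    (π ℓ : EuclideanSpace ℝ (Fin d) → ℝ) (θ : EuclideanSpace ℝ (Fin d)) : ℝ :=
  Real.exp (ℓ θ) * π θ / ∫ t in Θ, Real.exp (ℓ t) * π t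

/-- The quasi-posterior risk `Q_n(ζ) = ∫_Θ ρ_n(θ - ζ) p_n(θ) dθ`, where `ℓ = L_n`. -/
def risk {d : ℕ} (Θ : Set (EuclideanSpace ℝ (Fin d)))
    (ρ π ℓ : EuclideanSpace ℝ (Fin d) → ℝ) (n : ℕ) (ζ : EuclideanSpace ℝ (Fin d)) : ℝ :=
  ∫ θ in Θ, scaledLoss ρ n (θ - ζ) * quasiPosterior Θ π ℓ θ

/-- `θ̂` is a sequence of Laplace-type estimators: `θ̂_n` minimizes the risk `Q_n` over `Θ`. -/
def IsLTE {d : ℕ} {Ω : Type*} (Θ : Set (EuclideanSpace ℝ (Fin d)))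
    (ρ π : EuclideanSpace ℝ (Fin d) → ℝ) (L : ℕ → EuclideanSpace ℝ (Fin d) → Ω → ℝ)
    (θhat : ℕ → Ω → EuclideanSpace ℝ (Fin d)) : Prop :=
  ∀ n, 0 < n → ∀ ω, θhat n ω ∈ Θ ∧ IsMinOn (risk Θ ρ π (fun θ => L n θ ω) n) Θ (θhat n ω)

/-- `θ̂_ex` is a sequence of extremum estimators: `θ̂_ex` maximizes `L_n` over `Θ`. -/
def IsExtremumEstimator {d : ℕ} {Ω : Type*} (Θ : Set (EuclideanSpace ℝ (Fin d)))
    (L : ℕ → EuclideanSpace ℝ (Fin d) → Ω → ℝ)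
    (θex : ℕ → Ω → EuclideanSpace ℝ (Fin d)) : Prop :=
  ∀ n, 0 < n → ∀ ω, θex n ω ∈ Θ ∧ IsMaxOn (fun θ => L n θ ω) Θ (θex n ω)

/-! ### Matrices and the limit quantities -/

/-- The action of a matrix on Euclidean space. -/
def act {d : ℕ} (A : Matrix (Fin d) (Fin d) ℝ) (x : EuclideanSpace ℝ (Fin d)) :
    EuclideanSpace ℝ (Fin d) :=
  Matrix.toEuclideanLin A x

/-- The quadratic form `x' A x`. -/
def quad {d : ℕ} (A : Matrix (Fin d) (Fin d) ℝ) (x : EuclideanSpace ℝ (Fin d)) : ℝ :=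
  inner ℝ x (act A x)

/-- `A^{-1/2}` for a symmetric positive definite matrix `A`. -/
def invSqrt {d : ℕ} (A : Matrix (Fin d) (Fin d) ℝ) : Matrix (Fin d) (Fin d) ℝ :=
  cfc (fun x : ℝ => (√x)⁻¹) A

/-- The density `√(det J / (2π)^d) exp(- h' J h / 2)` of `N(0, J⁻¹)`. -/
def gaussianDensity {d : ℕ} (J : Matrix (Fin d) (Fin d) ℝ) (h : EuclideanSpace ℝ (Fin d)) : ℝ :=
  √(J.det / (2 * Real.pi) ^ d) * Real.exp (-(1 / 2) * quad J h)

/-- `ξ_J`: the minimizer over `z ∈ ℝ^d` of `∫ ρ(u - z) p_J(u) du`, where `p_J` is the density of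
`N(0, J⁻¹)`. -/
def xi {d : ℕ} (ρ : EuclideanSpace ℝ (Fin d) → ℝ) (J : Matrix (Fin d) (Fin d) ℝ) :
    EuclideanSpace ℝ (Fin d) :=
  Classical.epsilon fun z => IsMinOn
    (fun z : EuclideanSpace ℝ (Fin d) => ∫ u, ρ (u - z) * gaussianDensity J u) Set.univ z

/-- `U_n = J_n⁻¹ Δ_n / √n`. -/
def U {d : ℕ} {Ω : Type*} (J : ℕ → Matrix (Fin d) (Fin d) ℝ)
    (Δ : ℕ → Ω → EuclideanSpace ℝ (Fin d)) (n : ℕ) (ω : Ω) : EuclideanSpace ℝ (Fin d) :=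
  (√(n : ℝ))⁻¹ • act (J n)⁻¹ (Δ n ω)

/-- The remainder `R_n(θ)` of the quadratic expansion of `L_n` at `θ₀`, defined by
`L_n(θ) - L_n(θ₀) = (θ - θ₀)' Δ_n - (θ - θ₀)' [n J_n] (θ - θ₀) / 2 + R_n(θ)`. -/
def remainder {d : ℕ} {Ω : Type*} (L : ℕ → EuclideanSpace ℝ (Fin d) → Ω → ℝ)
    (θ₀ : EuclideanSpace ℝ (Fin d)) (J : ℕ → Matrix (Fin d) (Fin d) ℝ)
    (Δ : ℕ → Ω → EuclideanSpace ℝ (Fin d)) (n : ℕ) (θ : EuclideanSpace ℝ (Fin d)) (ω : Ω) : ℝ :=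
  L n θ ω - L n θ₀ ω
    - (inner ℝ (θ - θ₀) (Δ n ω) - 1 / 2 * quad ((n : ℝ) • J n) (θ - θ₀))

/-! ### The assumptions -/

/-- The standard measurability properties of the criterion functions. -/
structure MeasurableCriterion {d : ℕ} {Ω : Type*} [MeasurableSpace Ω]
    (Θ : Set (EuclideanSpace ℝ (Fin d))) (L : ℕ → EuclideanSpace ℝ (Fin d) → Ω → ℝ) : Prop where
  measurable_param : ∀ n, 0 < n → ∀ ω, Measurable fun θ : Θ => L n θ ω
  measurable_sample : ∀ n, 0 < n → ∀ θ ∈ Θ, Measurable (L n θ)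

/-- Parameter: `θ₀` is an interior point of the compact convex set `Θ`. -/
structure ParameterAssumption {d : ℕ} (Θ : Set (EuclideanSpace ℝ (Fin d)))
    (θ₀ : EuclideanSpace ℝ (Fin d)) : Prop where
  isCompact : IsCompact Θ
  convex : Convex ℝ Θ
  mem_interior : θ₀ ∈ interior Θ

/-- Penalty function `ρ` and weighting function `π`. -/
structure PenaltyAssumption {d : ℕ} (Θ : Set (EuclideanSpace ℝ (Fin d)))
    (ρ π : EuclideanSpace ℝ (Fin d) → ℝ) : Prop where
  nonneg : ∀ u, 0 ≤ ρ u
  eq_zero_iff : ∀ u, ρ u = 0 ↔ u = 0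
  convex : ConvexOn ℝ Set.univ ρ
  growth : ∃ p : ℝ, 1 ≤ p ∧ ∀ h, ρ h ≤ 1 + ‖h‖ ^ p
  unique_min : ∀ a : Matrix (Fin d) (Fin d) ℝ, a.PosDef →
    ∃! ξ : EuclideanSpace ℝ (Fin d), IsMinOn
      (fun ξ : EuclideanSpace ℝ (Fin d) => ∫ u, ρ (u - ξ) * Real.exp (-quad a u)) Set.univ ξ
  prior_continuous : ContinuousOn π Θ
  prior_pos : ∃ c : ℝ, 0 < c ∧ ∀ θ ∈ Θ, c ≤ π θ
  prior_density : ∫ θ in Θ, π θ = 1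

/-- Identifiability: for every `δ > 0` there is `ε > 0` such that
`liminf P_* { sup_{|θ - θ₀| ≥ δ} (L_n(θ) - L_n(θ₀)) / n ≤ - ε } = 1`. -/
def IdentifiabilityAssumption {d : ℕ} {Ω : Type*} [MeasurableSpace Ω] (P : Measure Ω)
    (Θ : Set (EuclideanSpace ℝ (Fin d))) (θ₀ : EuclideanSpace ℝ (Fin d))
    (L : ℕ → EuclideanSpace ℝ (Fin d) → Ω → ℝ) : Prop :=
  ∀ δ : ℝ, 0 < δ → ∃ ε : ℝ, 0 < ε ∧
    liminf (fun n : ℕ => innerProb P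
      {ω | ∀ θ ∈ Θ, δ ≤ ‖θ - θ₀‖ → 1 / (n : ℝ) * (L n θ ω - L n θ₀ ω) ≤ -ε}) atTop = 1

/-- The matrices `A n`, `n ≥ 1`, are symmetric, bounded and uniformly in `n` positive definite. -/
structure UniformlyPosDef {d : ℕ} (A : ℕ → Matrix (Fin d) (Fin d) ℝ) : Prop where
  symm : ∀ n, 0 < n → (A n).IsHermitian
  bounded : ∃ C : ℝ, ∀ n, 0 < n → ∀ i j, |A n i j| ≤ C
  posDef : ∃ c : ℝ, 0 < c ∧ ∀ n, 0 < n → ∀ x, c * ‖x‖ ^ 2 ≤ quad (A n) x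

/-- Expansion: `L_n` has a stochastic quadratic expansion at `θ₀` with score `Δ n`, Hessian
`J n` and score variance `V n`, and with the Huber-type conditions on the remainder `R_n`. An event
`{ sup_{θ ∈ S} f(θ) > ε }` is written as `{ ∃ θ ∈ S, f(θ) > ε }`. -/
structure ExpansionAssumption {d : ℕ} {Ω : Type*} [MeasurableSpace Ω] (P : Measure Ω)
    [IsProbabilityMeasure P] (Θ : Set (EuclideanSpace ℝ (Fin d)))
    (θ₀ : EuclideanSpace ℝ (Fin d)) (L : ℕ → EuclideanSpace ℝ (Fin d) → Ω → ℝ)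
    (J V : ℕ → Matrix (Fin d) (Fin d) ℝ) (Δ : ℕ → Ω → EuclideanSpace ℝ (Fin d)) : Prop where
  measurable_score : ∀ n, 0 < n → Measurable (Δ n)
  clt : TendstoInDistribution (fun (n : ℕ) ω => act (invSqrt (V n)) ((√(n : ℝ))⁻¹ • Δ n ω)) atTop
    (id : EuclideanSpace ℝ (Fin d) → EuclideanSpace ℝ (Fin d)) (fun _ => P)
    (stdGaussian (EuclideanSpace ℝ (Fin d)))
  hessian : UniformlyPosDef J
  variance : UniformlyPosDef V
  huber : ∀ ε : ℝ, 0 < ε → ∃ δ : ℝ, 0 < δ ∧ ∃ M : ℝ, 0 < M ∧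
    limsup (fun n : ℕ => P {ω | ∃ θ ∈ Θ, M / √(n : ℝ) ≤ ‖θ - θ₀‖ ∧ ‖θ - θ₀‖ ≤ δ ∧
      ε < |remainder L θ₀ J Δ n θ ω| / (n * ‖θ - θ₀‖ ^ 2)}) atTop < ENNReal.ofReal ε ∧
    limsup (fun n : ℕ => P {ω | ∃ θ ∈ Θ, ‖θ - θ₀‖ ≤ M / √(n : ℝ) ∧
      ε < |remainder L θ₀ J Δ n θ ω|}) atTop = 0

end LTE

end

namespace LTE

/-! ### Symmetric positive definite matrices -/

section Matrices

variable {d : ℕ}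

theorem act_apply (A : Matrix (Fin d) (Fin d) ℝ) (x : EuclideanSpace ℝ (Fin d)) (i : Fin d) :
    act A x i = ∑ j, A i j * x j := by
  simp [act, Matrix.mulVec, dotProduct]

theorem quad_eq_sum (A : Matrix (Fin d) (Fin d) ℝ) (x : EuclideanSpace ℝ (Fin d)) :
    quad A x = ∑ i, (∑ j, A i j * x j) * x i := by
  simp [quad, PiLp.inner_apply, act_apply]

theorem act_sub (A : Matrix (Fin d) (Fin d) ℝ) (x y : EuclideanSpace ℝ (Fin d)) :
    act A (x - y) = act A x - act A y := map_sub _ _ _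

theorem act_neg (A : Matrix (Fin d) (Fin d) ℝ) (x : EuclideanSpace ℝ (Fin d)) :
    act A (-x) = -act A x := map_neg _ _

theorem act_smul (A : Matrix (Fin d) (Fin d) ℝ) (c : ℝ) (x : EuclideanSpace ℝ (Fin d)) :
    act A (c • x) = c • act A x := map_smul _ _ _

theorem act_mul (A B : Matrix (Fin d) (Fin d) ℝ) (x : EuclideanSpace ℝ (Fin d)) :
    act (A * B) x = act A (act B x) := by
  simp [act]

theorem act_one (x : EuclideanSpace ℝ (Fin d)) :
    act (1 : Matrix (Fin d) (Fin d) ℝ) x = x := by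
  simp [act]

theorem continuous_act (A : Matrix (Fin d) (Fin d) ℝ) : Continuous (act A) :=
  (Matrix.toEuclideanLin A).continuous_of_finiteDimensional

theorem tendsto_quad {ι : Type*} {l : Filter ι} {A : ι → Matrix (Fin d) (Fin d) ℝ}
    {A' : Matrix (Fin d) (Fin d) ℝ} {x : ι → EuclideanSpace ℝ (Fin d)}
    {x' : EuclideanSpace ℝ (Fin d)} (hA : Tendsto A l (𝓝 A')) (hx : Tendsto x l (𝓝 x')) :
    Tendsto (fun k => quad (A k) (x k)) l (𝓝 (quad A' x')) := by
  simp only [quad_eq_sum]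
  have hA' : ∀ i j, Tendsto (fun k => A k i j) l (𝓝 (A' i j)) := fun i j =>
    tendsto_pi_nhds.1 (tendsto_pi_nhds.1 hA i) j
  have hx' : ∀ i, Tendsto (fun k => x k i) l (𝓝 (x' i)) := fun i =>
    ((EuclideanSpace.proj i).continuous.tendsto x').comp hx
  exact tendsto_finsetSum _ fun i _ => (tendsto_finsetSum _ fun j _ =>
    (hA' i j).mul (hx' j)).mul (hx' i)

theorem tendsto_act {ι : Type*} {l : Filter ι} {A : ι → Matrix (Fin d) (Fin d) ℝ}
    {A' : Matrix (Fin d) (Fin d) ℝ} {x : ι → EuclideanSpace ℝ (Fin d)}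
    {x' : EuclideanSpace ℝ (Fin d)} (hA : Tendsto A l (𝓝 A')) (hx : Tendsto x l (𝓝 x')) :
    Tendsto (fun k => act (A k) (x k)) l (𝓝 (act A' x')) := by
  have hA' : ∀ i j, Tendsto (fun k => A k i j) l (𝓝 (A' i j)) := fun i j =>
    tendsto_pi_nhds.1 (tendsto_pi_nhds.1 hA i) j
  have hx' : ∀ i, Tendsto (fun k => x k i) l (𝓝 (x' i)) := fun i =>
    ((EuclideanSpace.proj i).continuous.tendsto x').comp hx
  have h : Tendsto (fun k => fun i => act (A k) (x k) i) l (𝓝 (fun i => act A' x' i)) := by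
    simp only [act_apply]
    exact tendsto_pi_nhds.2 fun i => tendsto_finsetSum _ fun j _ => (hA' i j).mul (hx' j)
  exact ((PiLp.continuous_toLp 2 (fun _ : Fin d => ℝ)).tendsto _).comp h

theorem continuous_quad (A : Matrix (Fin d) (Fin d) ℝ) : Continuous (quad A) :=
  continuous_iff_continuousAt.2 fun _ => tendsto_quad tendsto_const_nhds tendsto_id

theorem norm_act_le {A : Matrix (Fin d) (Fin d) ℝ} {C : ℝ} (hA : ∀ i j, |A i j| ≤ C)
    (x : EuclideanSpace ℝ (Fin d)) : ‖act A x‖ ≤ d * d * C * ‖x‖ := by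
  have hcoord : ∀ i, ‖act A x i‖ ≤ d * C * ‖x‖ := by
    intro i
    rw [act_apply]
    calc ‖∑ j, A i j * x j‖ ≤ ∑ j, ‖A i j * x j‖ := norm_sum_le _ _
      _ ≤ ∑ _j : Fin d, C * ‖x‖ := by
          refine Finset.sum_le_sum fun j _ => ?_
          rw [norm_mul]
          exact mul_le_mul (hA i j) (PiLp.norm_apply_le x j) (norm_nonneg _)
            ((abs_nonneg _).trans (hA i j))
      _ = d * C * ‖x‖ := by simp [mul_assoc]
  have hsum : act A x = ∑ i, EuclideanSpace.single i (act A x i) := by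
    ext i
    simp [Pi.single_apply]
  calc ‖act A x‖ ≤ ∑ i, ‖EuclideanSpace.single i (act A x i)‖ := by
        conv_lhs => rw [hsum]
        exact norm_sum_le _ _
    _ ≤ ∑ _i : Fin d, d * C * ‖x‖ := by
        refine Finset.sum_le_sum fun i _ => ?_
        rw [PiLp.norm_single]
        exact hcoord i
    _ = d * d * C * ‖x‖ := by simp [mul_assoc]

theorem inner_act_comm {A : Matrix (Fin d) (Fin d) ℝ} (hA : A.IsHermitian)
    (x y : EuclideanSpace ℝ (Fin d)) : inner ℝ (act A x) y = inner ℝ x (act A y) := by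
  have h := Matrix.toEuclideanLin_conjTranspose_eq_adjoint A
  rw [hA.eq] at h
  rw [act, act]
  conv_lhs => rw [h]
  exact LinearMap.adjoint_inner_left _ _ _

theorem quad_sub {A : Matrix (Fin d) (Fin d) ℝ} (hA : A.IsHermitian)
    (x y : EuclideanSpace ℝ (Fin d)) :
    quad A (x - y) = quad A x - 2 * inner ℝ x (act A y) + quad A y := by
  have h : inner ℝ y (act A x) = inner ℝ x (act A y) := by
    rw [← inner_act_comm hA, real_inner_comm]
  simp only [quad, act_sub, inner_sub_left, inner_sub_right, h]
  ring

theorem quad_smul_vec (A : Matrix (Fin d) (Fin d) ℝ) (c : ℝ) (x : EuclideanSpace ℝ (Fin d)) :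
    quad A (c • x) = c ^ 2 * quad A x := by
  simp only [quad, act_smul, inner_smul_left, inner_smul_right]
  simp
  ring

theorem quad_smul (A : Matrix (Fin d) (Fin d) ℝ) (c : ℝ) (x : EuclideanSpace ℝ (Fin d)) :
    quad (c • A) x = c * quad A x := by
  simp [quad, act, inner_smul_right]

theorem quad_neg (A : Matrix (Fin d) (Fin d) ℝ) (x : EuclideanSpace ℝ (Fin d)) :
    quad A (-x) = quad A x := by
  simp [quad, act_neg]

theorem posDef_of_quad {A : Matrix (Fin d) (Fin d) ℝ} (hA : A.IsHermitian) {c : ℝ} (hc : 0 < c)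
    (h : ∀ x, c * ‖x‖ ^ 2 ≤ quad A x) : A.PosDef := by
  refine Matrix.PosDef.of_dotProduct_mulVec_pos hA fun x hx => ?_
  have hx' : WithLp.toLp 2 x ≠ (0 : EuclideanSpace ℝ (Fin d)) := by
    simpa using hx
  have h1 : star x ⬝ᵥ A.mulVec x = quad A (WithLp.toLp 2 x) := by
    rw [quad_eq_sum]
    simp [dotProduct, Matrix.mulVec, mul_comm]
  rw [h1]
  exact lt_of_lt_of_le (by positivity) (h _)

theorem act_act_inv {A : Matrix (Fin d) (Fin d) ℝ} (hA : A.PosDef)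
    (x : EuclideanSpace ℝ (Fin d)) : act A (act A⁻¹ x) = x := by
  rw [← act_mul, Matrix.mul_nonsing_inv _ hA.det_pos.ne'.isUnit, act_one]

theorem invSqrt_isHermitian (A : Matrix (Fin d) (Fin d) ℝ) : (invSqrt A).IsHermitian :=
  cfc_predicate (R := ℝ) (p := IsSelfAdjoint) _ A

theorem invSqrt_mul_invSqrt_mul {A : Matrix (Fin d) (Fin d) ℝ} (hA : A.PosDef) :
    invSqrt A * invSqrt A * A = 1 := by
  have hsa : IsSelfAdjoint A := hA.1
  have hpos : ∀ x ∈ spectrum ℝ A, 0 < x := by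
    intro x hx
    rw [hA.1.spectrum_real_eq_range_eigenvalues] at hx
    obtain ⟨i, rfl⟩ := hx
    exact hA.eigenvalues_pos i
  have hcont : ContinuousOn (fun x : ℝ => (√x)⁻¹) (spectrum ℝ A) :=
    Real.continuous_sqrt.continuousOn.inv₀ fun x hx => (Real.sqrt_pos.2 (hpos x hx)).ne'
  rw [invSqrt, ← cfc_mul (fun x : ℝ => (√x)⁻¹) (fun x : ℝ => (√x)⁻¹) A hcont hcont]
  nth_rw 2 [← cfc_id ℝ A hsa]
  rw [← cfc_mul (fun x : ℝ => (√x)⁻¹ * (√x)⁻¹) id A (hcont.mul hcont) continuousOn_id]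
  rw [← cfc_one ℝ A hsa]
  refine cfc_congr fun x hx => ?_
  have := hpos x hx
  simp only [id, Pi.one_apply]
  rw [← mul_inv, Real.mul_self_sqrt this.le, inv_mul_cancel₀ this.ne']

theorem quad_eq_norm_act_invSqrt_sq {A : Matrix (Fin d) (Fin d) ℝ} (hA : A.PosDef)
    (y : EuclideanSpace ℝ (Fin d)) : quad A y = ‖act (invSqrt A) (act A y)‖ ^ 2 := by
  rw [← real_inner_self_eq_norm_sq, inner_act_comm (invSqrt_isHermitian A), ← act_mul, ← act_mul,
    invSqrt_mul_invSqrt_mul hA, act_one, quad, real_inner_comm]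

theorem norm_act_invSqrt_le {A : Matrix (Fin d) (Fin d) ℝ} (hA : A.IsHermitian) {c : ℝ}
    (hc : 0 < c) (h : ∀ x, c * ‖x‖ ^ 2 ≤ quad A x) (x : EuclideanSpace ℝ (Fin d)) :
    ‖act (invSqrt A) x‖ ≤ √(1 / c) * ‖x‖ := by
  have hpd := posDef_of_quad hA hc h
  set y := act A⁻¹ x with hy
  have hx : act A y = x := act_act_inv hpd x
  have h1 := quad_eq_norm_act_invSqrt_sq hpd y
  have h2 : quad A y ≤ ‖y‖ * ‖x‖ := by
    rw [quad, hx]; exact real_inner_le_norm _ _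
  rw [hx] at h1
  have h3 : c * ‖y‖ ≤ ‖x‖ := by
    rcases (norm_nonneg y).eq_or_lt with h0 | h0
    · rw [← h0]; simp
    · have := (h y).trans h2
      nlinarith
  refine abs_le_of_sq_le_sq' ?_ (by positivity) |>.2
  rw [mul_pow, Real.sq_sqrt (by positivity), ← h1]
  calc quad A y ≤ ‖y‖ * ‖x‖ := h2
    _ ≤ (‖x‖ / c) * ‖x‖ := by
        gcongr
        rw [le_div_iff₀ hc]; linarith
    _ = 1 / c * ‖x‖ ^ 2 := by ring

theorem norm_le_norm_act_invSqrt {A : Matrix (Fin d) (Fin d) ℝ} (hA : A.IsHermitian) {c C : ℝ}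
    (hc : 0 < c) (h : ∀ x, c * ‖x‖ ^ 2 ≤ quad A x) (hC : ∀ x, ‖act A x‖ ≤ C * ‖x‖) (hC0 : 0 ≤ C)
    (x : EuclideanSpace ℝ (Fin d)) : ‖x‖ ≤ C * √(1 / c) * ‖act (invSqrt A) x‖ := by
  have hpd := posDef_of_quad hA hc h
  set y := act A⁻¹ x with hy
  have hx : act A y = x := act_act_inv hpd x
  have h1 := quad_eq_norm_act_invSqrt_sq hpd y
  rw [hx] at h1
  have h2 : ‖y‖ ≤ √(1 / c) * ‖act (invSqrt A) x‖ := by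
    refine abs_le_of_sq_le_sq' ?_ (by positivity) |>.2
    rw [mul_pow, Real.sq_sqrt (by positivity), ← h1, one_div, inv_mul_eq_div, le_div_iff₀ hc]
    linarith [h y]
  calc ‖x‖ = ‖act A y‖ := by rw [hx]
    _ ≤ C * ‖y‖ := hC y
    _ ≤ C * (√(1 / c) * ‖act (invSqrt A) x‖) := by gcongr
    _ = _ := by ring

theorem inner_sub_quad_eq {A : Matrix (Fin d) (Fin d) ℝ} (hA : A.PosDef)
    (x s : EuclideanSpace ℝ (Fin d)) :
    inner ℝ x s - 1 / 2 * quad A x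
      = 1 / 2 * quad A (act A⁻¹ s) - 1 / 2 * quad A (x - act A⁻¹ s) := by
  rw [quad_sub hA.1, act_act_inv hA]
  ring

end Matrices

/-! ### Convergence of minimizers of convex risks -/

section Argmin

variable {d : ℕ}

theorem continuous_of_convexOn {ρ : EuclideanSpace ℝ (Fin d) → ℝ}
    (hρ : ConvexOn ℝ Set.univ ρ) : Continuous ρ :=
  continuousOn_univ.1 (hρ.continuousOn isOpen_univ)

theorem integrable_exp_neg_mul_norm_sq {b : ℝ} (hb : 0 < b) :
    Integrable (fun u : EuclideanSpace ℝ (Fin d) => Real.exp (-b * ‖u‖ ^ 2)) := by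
  have h := (GaussianFourier.integrable_cexp_neg_mul_sq_norm_add (V := EuclideanSpace ℝ (Fin d))
    (b := (b : ℂ)) (by simpa using hb) 0 0).norm
  refine h.congr (Eventually.of_forall fun u => ?_)
  simp only [Complex.norm_exp]
  congr 1
  simp [← Complex.ofReal_pow]

/-- Polynomial growth implies exponential growth. -/
theorem one_add_rpow_le_exp {p t : ℝ} (hp : 1 ≤ p) (ht : 0 ≤ t) :
    1 + t ^ p ≤ 2 * Real.exp (p * t) := by
  have h1 : 1 ≤ Real.exp (p * t) := Real.one_le_exp (by positivity)
  have h2 : t ^ p ≤ Real.exp (p * t) := by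
    calc t ^ p ≤ (Real.exp t) ^ p :=
          Real.rpow_le_rpow ht (by linarith [Real.add_one_le_exp t]) (by linarith)
      _ = Real.exp (p * t) := by rw [← Real.exp_mul, mul_comm]
  linarith

theorem exp_growth_mul_gaussian_le {a c r : ℝ} (ha : 0 ≤ a) (hc : 0 < c)
    {h v : EuclideanSpace ℝ (Fin d)} (hv : ‖v‖ ≤ r) :
    Real.exp (a * ‖h - v‖) * Real.exp (-c * ‖h‖ ^ 2)
      ≤ Real.exp (a * r + a ^ 2 / (2 * c)) * Real.exp (-(c / 2) * ‖h‖ ^ 2) := by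
  rw [← Real.exp_add, ← Real.exp_add, Real.exp_le_exp]
  have h1 : a * ‖h - v‖ ≤ a * ‖h‖ + a * r := by
    rw [← mul_add]
    exact mul_le_mul_of_nonneg_left ((norm_sub_le _ _).trans (by linarith)) ha
  have h2 : a * ‖h‖ ≤ a ^ 2 / (2 * c) + c / 2 * ‖h‖ ^ 2 := by
    have : a ^ 2 / (2 * c) + c / 2 * ‖h‖ ^ 2 - a * ‖h‖ = (a - c * ‖h‖) ^ 2 / (2 * c) := by
      field_simp
      ring
    have h3 : 0 ≤ (a - c * ‖h‖) ^ 2 / (2 * c) := by positivity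
    linarith
  linarith

/-- The risk `∫ ρ(h - v) g(h) dh`, depending on `g` and `v`, is continuous along dominated
pointwise convergent weights. -/
theorem tendsto_integral_loss {ι : Type*} {l : Filter ι} [l.IsCountablyGenerated]
    {ρ : EuclideanSpace ℝ (Fin d) → ℝ} (hcont : Continuous ρ) (hρ0 : ∀ u, 0 ≤ ρ u) {a : ℝ}
    (ha : 0 ≤ a) (hρ : ∀ u, ρ u ≤ 2 * Real.exp (a * ‖u‖))
    {g : ι → EuclideanSpace ℝ (Fin d) → ℝ} {g' : EuclideanSpace ℝ (Fin d) → ℝ} {C c : ℝ}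
    (hc : 0 < c) (hgm : ∀ᶠ k in l, Measurable (g k)) (hg0 : ∀ᶠ k in l, ∀ h, 0 ≤ g k h)
    (hg : ∀ᶠ k in l, ∀ h, g k h ≤ C * Real.exp (-c * ‖h‖ ^ 2))
    (hlim : ∀ h, Tendsto (fun k => g k h) l (𝓝 (g' h)))
    {v : ι → EuclideanSpace ℝ (Fin d)} {v' : EuclideanSpace ℝ (Fin d)}
    (hv : Tendsto v l (𝓝 v')) :
    Tendsto (fun k => ∫ h, ρ (h - v k) * g k h) l (𝓝 (∫ h, ρ (h - v') * g' h)) := by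
  refine tendsto_integral_filter_of_dominated_convergence
    (fun h => 2 * |C| * Real.exp (a * (‖v'‖ + 1) + a ^ 2 / (2 * c)) *
      Real.exp (-(c / 2) * ‖h‖ ^ 2)) ?_ ?_ ?_ ?_
  · filter_upwards [hgm] with k hk
    exact ((hcont.comp (continuous_id.sub continuous_const)).measurable.mul
      hk).aestronglyMeasurable
  · have hvb : ∀ᶠ k in l, ‖v k‖ ≤ ‖v'‖ + 1 :=
      (hv.norm.eventually_lt_const (lt_add_one _)).mono fun _ h => h.le
    filter_upwards [hg0, hg, hvb] with k h0 h1 h2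
    refine Eventually.of_forall fun h => ?_
    rw [Real.norm_of_nonneg (mul_nonneg (hρ0 _) (h0 h))]
    calc ρ (h - v k) * g k h
        ≤ (2 * Real.exp (a * ‖h - v k‖)) * (|C| * Real.exp (-c * ‖h‖ ^ 2)) := by
          refine mul_le_mul (hρ _) ((h1 h).trans ?_) (h0 h) (by positivity)
          gcongr
          exact le_abs_self C
      _ = 2 * |C| * (Real.exp (a * ‖h - v k‖) * Real.exp (-c * ‖h‖ ^ 2)) := by ring
      _ ≤ 2 * |C| * (Real.exp (a * (‖v'‖ + 1) + a ^ 2 / (2 * c)) *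
            Real.exp (-(c / 2) * ‖h‖ ^ 2)) := by
          gcongr 2 * |C| * ?_
          exact exp_growth_mul_gaussian_le ha hc h2
      _ = _ := by ring
  · exact (integrable_exp_neg_mul_norm_sq (half_pos hc)).const_mul _
  · exact Eventually.of_forall fun h =>
      ((hcont.tendsto _).comp (tendsto_const_nhds.sub hv)).mul (hlim h)

theorem integrable_loss {ρ : EuclideanSpace ℝ (Fin d) → ℝ} (hcont : Continuous ρ)
    (hρ0 : ∀ u, 0 ≤ ρ u) {a : ℝ} (ha : 0 ≤ a) (hρ : ∀ u, ρ u ≤ 2 * Real.exp (a * ‖u‖))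
    {g : EuclideanSpace ℝ (Fin d) → ℝ} {C c : ℝ} (hc : 0 < c) (hgm : Measurable g)
    (hg0 : ∀ h, 0 ≤ g h) (hg : ∀ h, g h ≤ C * Real.exp (-c * ‖h‖ ^ 2))
    (v : EuclideanSpace ℝ (Fin d)) : Integrable (fun h => ρ (h - v) * g h) := by
  refine Integrable.mono' (g := fun h => 2 * |C| * Real.exp (a * ‖v‖ + a ^ 2 / (2 * c)) *
      Real.exp (-(c / 2) * ‖h‖ ^ 2))
    ((integrable_exp_neg_mul_norm_sq (half_pos hc)).const_mul _)
    ((hcont.comp (continuous_id.sub continuous_const)).measurable.mul hgm).aestronglyMeasurable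
    (Eventually.of_forall fun h => ?_)
  rw [Real.norm_of_nonneg (mul_nonneg (hρ0 _) (hg0 h))]
  calc ρ (h - v) * g h
      ≤ (2 * Real.exp (a * ‖h - v‖)) * (|C| * Real.exp (-c * ‖h‖ ^ 2)) := by
        refine mul_le_mul (hρ _) ((hg h).trans ?_) (hg0 h) (by positivity)
        gcongr
        exact le_abs_self C
    _ = 2 * |C| * (Real.exp (a * ‖h - v‖) * Real.exp (-c * ‖h‖ ^ 2)) := by ring
    _ ≤ 2 * |C| * (Real.exp (a * ‖v‖ + a ^ 2 / (2 * c)) * Real.exp (-(c / 2) * ‖h‖ ^ 2)) := by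
        gcongr 2 * |C| * ?_
        exact exp_growth_mul_gaussian_le ha hc le_rfl
    _ = _ := by ring

/-- If the risk at `z` is at most the risk at `w`, then the same holds on the segment. -/
theorem integral_loss_segment_le {ρ : EuclideanSpace ℝ (Fin d) → ℝ}
    (hconv : ConvexOn ℝ Set.univ ρ) {g : EuclideanSpace ℝ (Fin d) → ℝ} (hg0 : ∀ h, 0 ≤ g h)
    (hint : ∀ v, Integrable (fun h => ρ (h - v) * g h)) {w z : EuclideanSpace ℝ (Fin d)}
    (hz : ∫ h, ρ (h - z) * g h ≤ ∫ h, ρ (h - w) * g h) {t : ℝ} (ht0 : 0 ≤ t) (ht1 : t ≤ 1) :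
    ∫ h, ρ (h - (w + t • (z - w))) * g h ≤ ∫ h, ρ (h - w) * g h := by
  calc ∫ h, ρ (h - (w + t • (z - w))) * g h
      ≤ ∫ h, ((1 - t) * (ρ (h - w) * g h) + t * (ρ (h - z) * g h)) := by
        refine integral_mono (hint _) (((hint w).const_mul _).add ((hint z).const_mul _))
          fun h => ?_
        have h1 : h - (w + t • (z - w)) = (1 - t) • (h - w) + t • (h - z) := by
          simp only [smul_sub, sub_smul, one_smul]; abel
        have h2 := hconv.2 (Set.mem_univ (h - w)) (Set.mem_univ (h - z)) (sub_nonneg.2 ht1) ht0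
          (by ring)
        simp only [h1, smul_eq_mul] at h2 ⊢
        nlinarith [mul_le_mul_of_nonneg_right h2 (hg0 h)]
    _ = (1 - t) * (∫ h, ρ (h - w) * g h) + t * ∫ h, ρ (h - z) * g h := by
        rw [integral_add ((hint w).const_mul _) ((hint z).const_mul _),
          integral_const_mul, integral_const_mul]
    _ ≤ ∫ h, ρ (h - w) * g h := by nlinarith

/-- Minimizers of convex risks converge to the unique minimizer of the limiting risk. -/
theorem tendsto_argmin {ρ : EuclideanSpace ℝ (Fin d) → ℝ} (hconv : ConvexOn ℝ Set.univ ρ)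
    (hρ0 : ∀ u, 0 ≤ ρ u) {a : ℝ} (ha : 0 ≤ a) (hρ : ∀ u, ρ u ≤ 2 * Real.exp (a * ‖u‖))
    {g : ℕ → EuclideanSpace ℝ (Fin d) → ℝ} {g' : EuclideanSpace ℝ (Fin d) → ℝ} {C c : ℝ}
    (hc : 0 < c) (hgm : ∀ᶠ k in atTop, Measurable (g k))
    (hg0 : ∀ᶠ k in atTop, ∀ h, 0 ≤ g k h)
    (hg : ∀ᶠ k in atTop, ∀ h, g k h ≤ C * Real.exp (-c * ‖h‖ ^ 2))
    (hlim : ∀ h, Tendsto (fun k => g k h) atTop (𝓝 (g' h)))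
    {w : EuclideanSpace ℝ (Fin d)}
    (hw : ∀ z, ∫ h, ρ (h - z) * g' h ≤ ∫ h, ρ (h - w) * g' h → z = w)
    {z : ℕ → EuclideanSpace ℝ (Fin d)}
    (hz : ∀ᶠ k in atTop, ∫ h, ρ (h - z k) * g k h ≤ ∫ h, ρ (h - w) * g k h) :
    Tendsto z atTop (𝓝 w) := by
  have hcont := continuous_of_convexOn hconv
  by_contra hnot
  rw [Metric.tendsto_nhds] at hnot
  push Not at hnot
  obtain ⟨r, hr, hfr⟩ := hnot
  obtain ⟨φ, hφ, hφr⟩ := extraction_of_frequently_atTop hfr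
  have hφt := hφ.tendsto_atTop
  set y : ℕ → EuclideanSpace ℝ (Fin d) := fun k =>
    w + (r / dist (z (φ k)) w) • (z (φ k) - w) with hy
  have hpos : ∀ k, 0 < dist (z (φ k)) w := fun k => hr.trans_le (hφr k)
  have hys : ∀ k, y k ∈ Metric.sphere w r := by
    intro k
    have := (hpos k).ne'
    rw [mem_sphere_iff_norm, hy, add_sub_cancel_left, norm_smul, ← dist_eq_norm,
      Real.norm_of_nonneg (div_nonneg hr.le (hpos k).le), div_mul_cancel₀ _ this]
  obtain ⟨y', hy's, ψ, hψ, hψy⟩ := (isCompact_sphere w r).tendsto_subseq hys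
  have hψt := hφt.comp hψ.tendsto_atTop
  have hle : ∀ᶠ k in atTop, ∫ h, ρ (h - y (ψ k)) * g (φ (ψ k)) h
      ≤ ∫ h, ρ (h - w) * g (φ (ψ k)) h := by
    filter_upwards [hψt.eventually hgm, hψt.eventually hg0, hψt.eventually hg,
      hψt.eventually hz] with k h1 h2 h3 h4
    exact integral_loss_segment_le hconv h2 (integrable_loss hcont hρ0 ha hρ hc h1 h2 h3) h4
      (div_nonneg hr.le (hpos _).le) ((div_le_one (hpos _)).2 (hφr _))
  have hT1 := tendsto_integral_loss hcont hρ0 ha hρ hc (hψt.eventually hgm)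
    (hψt.eventually hg0) (hψt.eventually hg) (fun h => (hlim h).comp hψt) hψy
  have hT2 := tendsto_integral_loss hcont hρ0 ha hρ hc (hψt.eventually hgm)
    (hψt.eventually hg0) (hψt.eventually hg) (fun h => (hlim h).comp hψt)
    (tendsto_const_nhds (x := w))
  have := hw y' (le_of_tendsto_of_tendsto hT1 hT2 hle)
  rw [mem_sphere_iff_norm, this, sub_self, norm_zero] at hy's
  exact hr.ne hy's

end Argmin

/-! ### Local asymptotics along nonrandom sequences -/

section LocalSequence

variable {d : ℕ}

/-- A sequence of nonrandom criterion functions `ℓ k` of sample size `n k` which are, in the local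
parameter `h = √n (θ - θ₀)`, asymptotically quadratic with convergent Hessian `A k` and score
`s k`, and which are dominated by a Gaussian exponent. -/
structure IsLocalSequence (Θ : Set (EuclideanSpace ℝ (Fin d))) (θ₀ : EuclideanSpace ℝ (Fin d))
    (n : ℕ → ℕ) (ℓ : ℕ → EuclideanSpace ℝ (Fin d) → ℝ) (A : ℕ → Matrix (Fin d) (Fin d) ℝ)
    (s : ℕ → EuclideanSpace ℝ (Fin d)) (A' : Matrix (Fin d) (Fin d) ℝ)
    (s' : EuclideanSpace ℝ (Fin d)) : Prop where
  size_tendsto : Tendsto n atTop atTop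
  size_pos : ∀ k, 0 < n k
  symm : ∀ k, (A k).IsHermitian
  posDef : ∃ c : ℝ, 0 < c ∧ ∀ k x, c * ‖x‖ ^ 2 ≤ quad (A k) x
  hessian_tendsto : Tendsto A atTop (𝓝 A')
  score_tendsto : Tendsto s atTop (𝓝 s')
  expansion : ∀ K ε : ℝ, 0 < ε → ∀ᶠ k in atTop, ∀ θ ∈ Θ, ‖√(n k : ℝ) • (θ - θ₀)‖ ≤ K →
    |ℓ k θ - ℓ k θ₀ - (inner ℝ (√(n k : ℝ) • (θ - θ₀)) (s k)
      - 1 / 2 * quad (A k) (√(n k : ℝ) • (θ - θ₀)))| ≤ ε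
  domination : ∃ C c : ℝ, 0 < c ∧ ∀ᶠ k in atTop, ∀ θ ∈ Θ,
    ℓ k θ - ℓ k θ₀ ≤ C - c * ‖√(n k : ℝ) • (θ - θ₀)‖ ^ 2

namespace IsLocalSequence

variable {Θ : Set (EuclideanSpace ℝ (Fin d))} {θ₀ : EuclideanSpace ℝ (Fin d)} {n : ℕ → ℕ}
  {ℓ : ℕ → EuclideanSpace ℝ (Fin d) → ℝ} {A : ℕ → Matrix (Fin d) (Fin d) ℝ}
  {s : ℕ → EuclideanSpace ℝ (Fin d)} {A' : Matrix (Fin d) (Fin d) ℝ}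
  {s' : EuclideanSpace ℝ (Fin d)}

theorem posDef_hessian (H : IsLocalSequence Θ θ₀ n ℓ A s A' s') (k : ℕ) : (A k).PosDef := by
  obtain ⟨c, hc, h⟩ := H.posDef
  exact posDef_of_quad (H.symm k) hc (h k)

theorem posDef_limit (H : IsLocalSequence Θ θ₀ n ℓ A s A' s') : A'.PosDef := by
  obtain ⟨c, hc, h⟩ := H.posDef
  refine posDef_of_quad (c := c) ?_ hc fun x => ?_
  · have h1 : Tendsto (fun k => (A k).conjTranspose) atTop (𝓝 A'.conjTranspose) :=
      (Continuous.matrix_conjTranspose continuous_id).tendsto A' |>.comp H.hessian_tendsto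
    simp only [fun k => (H.symm k).eq] at h1
    exact tendsto_nhds_unique h1 H.hessian_tendsto
  · exact ge_of_tendsto' (tendsto_quad H.hessian_tendsto tendsto_const_nhds) fun k => h k x

theorem tendsto_center (H : IsLocalSequence Θ θ₀ n ℓ A s A' s') :
    Tendsto (fun k => act (A k)⁻¹ (s k)) atTop (𝓝 (act A'⁻¹ s')) := by
  refine tendsto_act ?_ H.score_tendsto
  simp only [Matrix.inv_def, Ring.inverse_eq_inv']
  have hdet : Tendsto (fun k => (A k).det) atTop (𝓝 A'.det) :=
    ((Continuous.matrix_det continuous_id).tendsto A').comp H.hessian_tendsto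
  have hadj : Tendsto (fun k => (A k).adjugate) atTop (𝓝 A'.adjugate) :=
    ((Continuous.matrix_adjugate continuous_id).tendsto A').comp H.hessian_tendsto
  exact (hdet.inv₀ H.posDef_limit.det_pos.ne').smul hadj

theorem tendsto_sqrt_size (H : IsLocalSequence Θ θ₀ n ℓ A s A' s') :
    Tendsto (fun k => √(n k : ℝ)) atTop atTop :=
  Real.tendsto_sqrt_atTop.comp (tendsto_natCast_atTop_atTop.comp H.size_tendsto)

theorem sqrt_size_pos (H : IsLocalSequence Θ θ₀ n ℓ A s A' s') (k : ℕ) : 0 < √(n k : ℝ) :=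
  Real.sqrt_pos.2 (Nat.cast_pos.2 (H.size_pos k))

theorem tendsto_rescale (H : IsLocalSequence Θ θ₀ n ℓ A s A' s')
    {v : ℕ → EuclideanSpace ℝ (Fin d)} {v' : EuclideanSpace ℝ (Fin d)}
    (hv : Tendsto v atTop (𝓝 v')) :
    Tendsto (fun k => θ₀ + (√(n k : ℝ))⁻¹ • v k) atTop (𝓝 θ₀) := by
  have h := (H.tendsto_sqrt_size.inv_tendsto_atTop.smul hv).const_add θ₀
  simpa using h

theorem eventually_rescale_mem (H : IsLocalSequence Θ θ₀ n ℓ A s A' s')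
    (h1 : ParameterAssumption Θ θ₀) {v : ℕ → EuclideanSpace ℝ (Fin d)}
    {v' : EuclideanSpace ℝ (Fin d)} (hv : Tendsto v atTop (𝓝 v')) :
    ∀ᶠ k in atTop, θ₀ + (√(n k : ℝ))⁻¹ • v k ∈ Θ :=
  (H.tendsto_rescale hv).eventually (mem_interior_iff_mem_nhds.1 h1.mem_interior)

theorem smul_rescale (H : IsLocalSequence Θ θ₀ n ℓ A s A' s') (k : ℕ)
    (v : EuclideanSpace ℝ (Fin d)) : √(n k : ℝ) • (θ₀ + (√(n k : ℝ))⁻¹ • v - θ₀) = v := by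
  rw [add_sub_cancel_left, smul_inv_smul₀ (H.sqrt_size_pos k).ne']

/-- Maximizers of `ℓ k` are asymptotically equivalent to the centers of the local expansion. -/
theorem tendsto_extremum (H : IsLocalSequence Θ θ₀ n ℓ A s A' s')
    (h1 : ParameterAssumption Θ θ₀) {θex : ℕ → EuclideanSpace ℝ (Fin d)}
    (hmem : ∀ k, θex k ∈ Θ) (hmax : ∀ k, IsMaxOn (ℓ k) Θ (θex k)) :
    Tendsto (fun k => √(n k : ℝ) • (θex k - θ₀) - act (A k)⁻¹ (s k)) atTop (𝓝 0) := by
  obtain ⟨C, c, hc, hdom⟩ := H.domination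
  obtain ⟨c₀, hc₀, hpd⟩ := H.posDef
  set m : ℕ → EuclideanSpace ℝ (Fin d) := fun k => act (A k)⁻¹ (s k) with hm
  have hmt : Tendsto m atTop (𝓝 (act A'⁻¹ s')) := H.tendsto_center
  have hmb : ∀ᶠ k in atTop, ‖m k‖ ≤ ‖act A'⁻¹ s'‖ + 1 :=
    (hmt.norm.eventually_lt_const (lt_add_one _)).mono fun _ h => h.le
  rw [Metric.tendsto_nhds]
  intro η hη
  have hε : 0 < c₀ * η ^ 2 / 8 := by positivity
  filter_upwards [hdom, hmb, H.eventually_rescale_mem h1 hmt,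
    H.expansion (max (√(C / c)) (‖act A'⁻¹ s'‖ + 1)) _ hε] with k hd hb hmk hexp
  have hθ₀ : θ₀ ∈ Θ := interior_subset h1.mem_interior
  have hnorm : ‖√(n k : ℝ) • (θex k - θ₀)‖ ≤ √(C / c) := by
    refine Real.le_sqrt_of_sq_le ?_
    rw [le_div_iff₀ hc]
    have h2 : ℓ k θ₀ ≤ ℓ k (θex k) := hmax k hθ₀
    linarith [hd _ (hmem k)]
  have e1 := abs_le.1 (hexp _ (hmem k) (hnorm.trans (le_max_left _ _)))
  have e2 := hexp _ hmk
  rw [H.smul_rescale] at e2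
  have e2 := abs_le.1 (e2 (hb.trans (le_max_right _ _)))
  rw [inner_sub_quad_eq (H.posDef_hessian k)] at e1 e2
  have h3 : ℓ k (θ₀ + (√(n k : ℝ))⁻¹ • m k) ≤ ℓ k (θex k) := hmax k hmk
  have h4 : quad (A k) (m k - act (A k)⁻¹ (s k)) = 0 := by
    rw [hm]; simp [quad]
  have h5 := hpd k (√(n k : ℝ) • (θex k - θ₀) - m k)
  rw [dist_zero_right]
  rw [h4] at e2
  refine abs_lt_of_sq_lt_sq' ?_ hη.le |>.2
  have h6 : c₀ * ‖√(n k : ℝ) • (θex k - θ₀) - m k‖ ^ 2 < c₀ * η ^ 2 := by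
    nlinarith [e1.1, e1.2, e2.1, e2.2]
  exact lt_of_mul_lt_mul_left h6 hc₀.le

end IsLocalSequence

end LocalSequence

/-! ### The limiting risk -/

section Xi

variable {d : ℕ} {Θ : Set (EuclideanSpace ℝ (Fin d))} {ρ π : EuclideanSpace ℝ (Fin d) → ℝ}

theorem existsUnique_isMinOn_gaussianRisk (h2 : PenaltyAssumption Θ ρ π)
    {A : Matrix (Fin d) (Fin d) ℝ} (hA : A.PosDef) :
    ∃! ξ : EuclideanSpace ℝ (Fin d), IsMinOn
      (fun ξ : EuclideanSpace ℝ (Fin d) => ∫ u, ρ (u - ξ) * Real.exp (-(1 / 2) * quad A u))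
      Set.univ ξ := by
  have h := h2.unique_min ((1 / 2 : ℝ) • A) (hA.smul (by norm_num))
  simpa only [quad_smul, neg_mul] using h

theorem isMinOn_xi (h2 : PenaltyAssumption Θ ρ π) {A : Matrix (Fin d) (Fin d) ℝ}
    (hA : A.PosDef) : IsMinOn
      (fun ξ : EuclideanSpace ℝ (Fin d) => ∫ u, ρ (u - ξ) * Real.exp (-(1 / 2) * quad A u))
      Set.univ (xi ρ A) := by
  have hκ : 0 < √(A.det / (2 * Real.pi) ^ d) :=
    Real.sqrt_pos.2 (div_pos hA.det_pos (by positivity))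
  have hfun : (fun z : EuclideanSpace ℝ (Fin d) => ∫ u, ρ (u - z) * gaussianDensity A u)
      = fun z => √(A.det / (2 * Real.pi) ^ d) *
        ∫ u, ρ (u - z) * Real.exp (-(1 / 2) * quad A u) := by
    funext z
    rw [← integral_const_mul]
    congr 1 with u
    rw [gaussianDensity]; ring
  have hiff : ∀ z, IsMinOn (fun z : EuclideanSpace ℝ (Fin d) =>
      ∫ u, ρ (u - z) * gaussianDensity A u) Set.univ z ↔ IsMinOn
      (fun ξ : EuclideanSpace ℝ (Fin d) => ∫ u, ρ (u - ξ) * Real.exp (-(1 / 2) * quad A u))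
      Set.univ z := by
    intro z
    rw [hfun]
    simp only [isMinOn_iff]
    exact forall₂_congr fun x _ => mul_le_mul_iff_right₀ hκ
  obtain ⟨z, hz, -⟩ := existsUnique_isMinOn_gaussianRisk h2 hA
  exact (hiff _).1 (Classical.epsilon_spec (p := fun z => IsMinOn (fun z =>
    ∫ u, ρ (u - z) * gaussianDensity A u) Set.univ z) ⟨z, (hiff z).2 hz⟩)

theorem eq_xi_of_gaussianRisk_le (h2 : PenaltyAssumption Θ ρ π) {A : Matrix (Fin d) (Fin d) ℝ}
    (hA : A.PosDef) {z : EuclideanSpace ℝ (Fin d)}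
    (hz : ∫ u, ρ (u - z) * Real.exp (-(1 / 2) * quad A u)
      ≤ ∫ u, ρ (u - xi ρ A) * Real.exp (-(1 / 2) * quad A u)) : z = xi ρ A := by
  refine (existsUnique_isMinOn_gaussianRisk h2 hA).unique ?_ (isMinOn_xi h2 hA)
  exact fun x hx => hz.trans (isMinOn_xi h2 hA hx)

theorem xi_eq_zero_of_even (h2 : PenaltyAssumption Θ ρ π) (hρ : ∀ h, ρ h = ρ (-h))
    {A : Matrix (Fin d) (Fin d) ℝ} (hA : A.PosDef) : xi ρ A = 0 := by
  have h : -xi ρ A = xi ρ A := by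
    refine eq_xi_of_gaussianRisk_le h2 hA (le_of_eq ?_)
    rw [← integral_neg_eq_self]
    congr 1 with u
    rw [quad_neg, hρ]
    congr 2
    abel
  have h' : (2 : ℝ) • xi ρ A = 0 := by
    rw [two_smul]
    nth_rw 1 [← h]
    simp
  exact (smul_eq_zero.1 h').resolve_left two_ne_zero

theorem PenaltyAssumption.exists_exp_growth (h2 : PenaltyAssumption Θ ρ π) :
    ∃ a : ℝ, 0 ≤ a ∧ ∀ u, ρ u ≤ 2 * Real.exp (a * ‖u‖) := by
  obtain ⟨p, hp, h⟩ := h2.growth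
  exact ⟨p, by linarith, fun u => (h u).trans (one_add_rpow_le_exp hp (norm_nonneg _))⟩

theorem tendsto_xi (h2 : PenaltyAssumption Θ ρ π) {A : ℕ → Matrix (Fin d) (Fin d) ℝ}
    {A' : Matrix (Fin d) (Fin d) ℝ} (hA : ∀ k, (A k).PosDef) (hA' : A'.PosDef) {c : ℝ}
    (hc : 0 < c) (hpd : ∀ k x, c * ‖x‖ ^ 2 ≤ quad (A k) x) (hlim : Tendsto A atTop (𝓝 A')) :
    Tendsto (fun k => xi ρ (A k)) atTop (𝓝 (xi ρ A')) := by
  obtain ⟨a, ha, hρ⟩ := h2.exists_exp_growth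
  refine tendsto_argmin (g := fun k u => Real.exp (-(1 / 2) * quad (A k) u))
    (g' := fun u => Real.exp (-(1 / 2) * quad A' u)) (C := 1) h2.convex h2.nonneg ha hρ
    (half_pos hc) ?_ ?_ ?_ ?_ (fun z => eq_xi_of_gaussianRisk_le h2 hA') ?_
  · exact Eventually.of_forall fun k =>
      (Real.continuous_exp.comp (continuous_const.mul (continuous_quad (A k)))).measurable
  · exact Eventually.of_forall fun k h => (Real.exp_pos _).le
  · refine Eventually.of_forall fun k h => ?_
    rw [one_mul, Real.exp_le_exp]
    linarith [hpd k h]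
  · exact fun h => (Real.continuous_exp.tendsto _).comp
      ((tendsto_quad hlim tendsto_const_nhds).const_mul _)
  · exact Eventually.of_forall fun k => isMinOn_xi h2 (hA k) (Set.mem_univ _)

/-- The limiting risk with a linear term is minimized at `ξ_A + A⁻¹ s` only. -/
theorem eq_of_shifted_gaussianRisk_le (h2 : PenaltyAssumption Θ ρ π)
    {A : Matrix (Fin d) (Fin d) ℝ} (hA : A.PosDef) (s : EuclideanSpace ℝ (Fin d)) {κ : ℝ}
    (hκ : 0 < κ) {z : EuclideanSpace ℝ (Fin d)}
    (hz : ∫ h, ρ (h - z) * (Real.exp (inner ℝ h s - 1 / 2 * quad A h) * κ)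
      ≤ ∫ h, ρ (h - (xi ρ A + act A⁻¹ s)) * (Real.exp (inner ℝ h s - 1 / 2 * quad A h) * κ)) :
    z = xi ρ A + act A⁻¹ s := by
  set m := act A⁻¹ s with hm
  have key : ∀ v, ∫ h, ρ (h - v) * (Real.exp (inner ℝ h s - 1 / 2 * quad A h) * κ)
      = Real.exp (1 / 2 * quad A m) * κ *
        ∫ u, ρ (u - (v - m)) * Real.exp (-(1 / 2) * quad A u) := by
    intro v
    rw [← integral_const_mul, ← integral_add_right_eq_self _ m]
    congr 1 with u
    have h1 : u + m - v = u - (v - m) := by abel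
    have h2 : 1 / 2 * quad A m - 1 / 2 * quad A u = 1 / 2 * quad A m + -(1 / 2) * quad A u := by
      ring
    rw [inner_sub_quad_eq hA, ← hm, add_sub_cancel_right, h1, h2, Real.exp_add]
    ring
  rw [key, key, add_sub_cancel_right] at hz
  have := eq_xi_of_gaussianRisk_le h2 hA (le_of_mul_le_mul_left hz (by positivity))
  rw [← this]; abel

end Xi

/-! ### Laplace-type estimators along nonrandom sequences -/

section LocalRisk

variable {d : ℕ} {Θ : Set (EuclideanSpace ℝ (Fin d))} {θ₀ : EuclideanSpace ℝ (Fin d)}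
  {ρ π : EuclideanSpace ℝ (Fin d) → ℝ}

/-- The unnormalized quasi-posterior weight, relative to its value at `θ₀` and extended by zero. -/
noncomputable def weight (Θ : Set (EuclideanSpace ℝ (Fin d))) (θ₀ : EuclideanSpace ℝ (Fin d))
    (π ℓ : EuclideanSpace ℝ (Fin d) → ℝ) : EuclideanSpace ℝ (Fin d) → ℝ :=
  Θ.indicator fun θ => Real.exp (ℓ θ - ℓ θ₀) * π θ

theorem weight_nonneg (h2 : PenaltyAssumption Θ ρ π) (ℓ : EuclideanSpace ℝ (Fin d) → ℝ)
    (θ : EuclideanSpace ℝ (Fin d)) : 0 ≤ weight Θ θ₀ π ℓ θ := by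
  obtain ⟨c, hc, h⟩ := h2.prior_pos
  exact Set.indicator_nonneg (fun θ hθ => mul_nonneg (Real.exp_pos _).le (hc.le.trans (h θ hθ))) θ

theorem measurable_weight (h1 : ParameterAssumption Θ θ₀) (h2 : PenaltyAssumption Θ ρ π)
    {ℓ : EuclideanSpace ℝ (Fin d) → ℝ} (hℓ : Measurable fun θ : Θ => ℓ θ) :
    Measurable (weight Θ θ₀ π ℓ) := by
  have hΘ : MeasurableSet Θ := h1.isCompact.isClosed.measurableSet
  refine measurable_of_restrict_of_restrict_compl hΘ ?_ ?_
  · have h : Set.domRestrict Θ (weight Θ θ₀ π ℓ)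
        = fun θ : Θ => Real.exp (ℓ θ - ℓ θ₀) * Set.domRestrict Θ π θ := by
      funext θ
      simp [weight, Set.domRestrict]
    rw [h]
    exact (Real.measurable_exp.comp (hℓ.sub_const _)).mul
      (continuousOn_iff_continuous_domRestrict.1 h2.prior_continuous).measurable
  · have h : Set.domRestrict Θᶜ (weight Θ θ₀ π ℓ) = fun _ => 0 := by
      funext θ
      have hθ : (θ : EuclideanSpace ℝ (Fin d)) ∉ Θ := θ.2
      simp [weight, Set.domRestrict, hθ]
    rw [h]
    exact measurable_const

theorem weight_le (h2 : PenaltyAssumption Θ ρ π) {ℓ : EuclideanSpace ℝ (Fin d) → ℝ} {B C c : ℝ}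
    (hB : ∀ θ ∈ Θ, π θ ≤ B) (hB0 : 0 ≤ B) {r : ℝ}
    (hℓ : ∀ θ ∈ Θ, ℓ θ - ℓ θ₀ ≤ C - c * ‖r • (θ - θ₀)‖ ^ 2) (θ : EuclideanSpace ℝ (Fin d)) :
    weight Θ θ₀ π ℓ θ ≤ Real.exp C * B * Real.exp (-c * ‖r • (θ - θ₀)‖ ^ 2) := by
  by_cases hθ : θ ∈ Θ
  · obtain ⟨c', hc', h⟩ := h2.prior_pos
    rw [weight, Set.indicator_of_mem hθ]
    calc Real.exp (ℓ θ - ℓ θ₀) * π θ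
        ≤ Real.exp (C + -c * ‖r • (θ - θ₀)‖ ^ 2) * B := by
          refine mul_le_mul (Real.exp_le_exp.2 (by linarith [hℓ θ hθ])) (hB θ hθ)
            (hc'.le.trans (h θ hθ)) (Real.exp_pos _).le
      _ = _ := by rw [Real.exp_add]; ring
  · rw [weight, Set.indicator_of_notMem hθ]
    positivity

theorem PenaltyAssumption.exists_prior_le (h2 : PenaltyAssumption Θ ρ π)
    (h1 : ParameterAssumption Θ θ₀) : ∃ B : ℝ, 0 ≤ B ∧ ∀ θ ∈ Θ, π θ ≤ B := by
  obtain ⟨B, hB⟩ := h1.isCompact.bddAbove_image h2.prior_continuous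
  exact ⟨|B|, abs_nonneg _, fun θ hθ => (hB ⟨θ, hθ, rfl⟩).trans (le_abs_self _)⟩

theorem integral_weight_pos (h1 : ParameterAssumption Θ θ₀) (h2 : PenaltyAssumption Θ ρ π)
    {ℓ : EuclideanSpace ℝ (Fin d) → ℝ} (hℓ : Measurable fun θ : Θ => ℓ θ) {C : ℝ}
    (hC : ∀ θ ∈ Θ, ℓ θ - ℓ θ₀ ≤ C) : 0 < ∫ θ, weight Θ θ₀ π ℓ θ := by
  obtain ⟨B, hB0, hB⟩ := h2.exists_prior_le h1
  obtain ⟨c, hc, hcπ⟩ := h2.prior_pos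
  have hΘ : MeasurableSet Θ := h1.isCompact.isClosed.measurableSet
  have hint : Integrable (weight Θ θ₀ π ℓ) := by
    have hconst : Integrable (Θ.indicator fun _ => Real.exp C * B) :=
      (integrable_indicator_iff hΘ).2
        (integrableOn_const h1.isCompact.measure_lt_top.ne)
    refine hconst.mono' (measurable_weight h1 h2 hℓ).aestronglyMeasurable
      (Eventually.of_forall fun θ => ?_)
    rw [Real.norm_of_nonneg (weight_nonneg h2 ℓ θ)]
    exact Set.indicator_le_indicator' fun hθ => mul_le_mul (Real.exp_le_exp.2 (hC θ hθ))
      (hB θ hθ) (hc.le.trans (hcπ θ hθ)) (Real.exp_pos _).le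
  rw [integral_pos_iff_support_of_nonneg (weight_nonneg h2 ℓ) hint]
  have hsub : interior Θ ⊆ Function.support (weight Θ θ₀ π ℓ) := by
    intro θ hθ
    rw [Function.mem_support, weight, Set.indicator_of_mem (interior_subset hθ)]
    exact (mul_pos (Real.exp_pos _) (hc.trans_le (hcπ θ (interior_subset hθ)))).ne'
  exact (isOpen_interior.measure_pos volume ⟨θ₀, h1.mem_interior⟩).trans_le (measure_mono hsub)

theorem integral_rescale {f : EuclideanSpace ℝ (Fin d) → ℝ} {r : ℝ} (hr : 0 < r)
    (θ₀ : EuclideanSpace ℝ (Fin d)) :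
    ∫ h, f (θ₀ + r⁻¹ • h) = r ^ d * ∫ θ, f θ := by
  rw [Measure.integral_comp_smul volume (fun h => f (θ₀ + h)), integral_add_left_eq_self]
  simp only [finrank_euclideanSpace, Fintype.card_fin, inv_pow, inv_inv, smul_eq_mul]
  rw [abs_of_pos (pow_pos hr d)]

/-- In the local parameter, the risk is a positive multiple of a risk on the whole space. -/
theorem exists_risk_eq (h1 : ParameterAssumption Θ θ₀) (h2 : PenaltyAssumption Θ ρ π)
    {ℓ : EuclideanSpace ℝ (Fin d) → ℝ} (hℓ : Measurable fun θ : Θ => ℓ θ) {C : ℝ}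
    (hC : ∀ θ ∈ Θ, ℓ θ - ℓ θ₀ ≤ C) {n : ℕ} (hn : 0 < n) :
    ∃ κ : ℝ, 0 < κ ∧ ∀ ζ, ∫ h, ρ (h - √(n : ℝ) • (ζ - θ₀)) *
      weight Θ θ₀ π ℓ (θ₀ + (√(n : ℝ))⁻¹ • h) = κ * risk Θ ρ π ℓ n ζ := by
  have hΘ : MeasurableSet Θ := h1.isCompact.isClosed.measurableSet
  have hr : 0 < √(n : ℝ) := Real.sqrt_pos.2 (Nat.cast_pos.2 hn)
  have hZ : ∫ t in Θ, Real.exp (ℓ t) * π t = Real.exp (ℓ θ₀) * ∫ θ, weight Θ θ₀ π ℓ θ := by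
    simp only [weight]
    rw [integral_indicator hΘ, ← integral_const_mul]
    congr 1 with t
    rw [← mul_assoc, ← Real.exp_add, add_sub_cancel]
  have hW := integral_weight_pos h1 h2 hℓ hC
  refine ⟨√(n : ℝ) ^ d * ∫ θ, weight Θ θ₀ π ℓ θ, by positivity, fun ζ => ?_⟩
  have hcv := integral_rescale
    (f := fun θ => ρ (√(n : ℝ) • (θ - ζ)) * weight Θ θ₀ π ℓ θ) hr θ₀
  have harg : ∀ h : EuclideanSpace ℝ (Fin d),
      √(n : ℝ) • (θ₀ + (√(n : ℝ))⁻¹ • h - ζ) = h - √(n : ℝ) • (ζ - θ₀) := by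
    intro h
    simp only [smul_sub, smul_add, smul_inv_smul₀ hr.ne']
    abel
  simp only [harg] at hcv
  rw [hcv, mul_assoc]
  congr 1
  rw [risk, ← integral_indicator hΘ, ← integral_const_mul]
  congr 1 with θ
  by_cases hθ : θ ∈ Θ
  · simp only [Set.indicator_of_mem hθ, weight, scaledLoss, quasiPosterior]
    rw [show ∫ t in Θ, Real.exp (ℓ t) * π t = _ from hZ, Real.exp_sub]
    have := Real.exp_pos (ℓ θ₀)
    simp only [weight] at hW ⊢
    field_simp
  · simp [Set.indicator_of_notMem hθ, weight]

/-- Laplace-type estimators along a local sequence converge to the minimizer of the limiting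
risk. -/
theorem IsLocalSequence.tendsto_minimizer {n : ℕ → ℕ} {ℓ : ℕ → EuclideanSpace ℝ (Fin d) → ℝ}
    {A : ℕ → Matrix (Fin d) (Fin d) ℝ} {s : ℕ → EuclideanSpace ℝ (Fin d)}
    {A' : Matrix (Fin d) (Fin d) ℝ} {s' : EuclideanSpace ℝ (Fin d)}
    (H : IsLocalSequence Θ θ₀ n ℓ A s A' s') (h1 : ParameterAssumption Θ θ₀)
    (h2 : PenaltyAssumption Θ ρ π) (hℓ : ∀ k, Measurable fun θ : Θ => ℓ k θ)
    {θhat : ℕ → EuclideanSpace ℝ (Fin d)}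
    (hmin : ∀ k, IsMinOn (risk Θ ρ π (ℓ k) (n k)) Θ (θhat k)) :
    Tendsto (fun k => √(n k : ℝ) • (θhat k - θ₀)) atTop (𝓝 (xi ρ A' + act A'⁻¹ s')) := by
  obtain ⟨a, ha, hρ⟩ := h2.exists_exp_growth
  obtain ⟨C, c, hc, hdom⟩ := H.domination
  obtain ⟨B, hB0, hB⟩ := h2.exists_prior_le h1
  obtain ⟨b, hb, hbπ⟩ := h2.prior_pos
  have hθ₀ : θ₀ ∈ Θ := interior_subset h1.mem_interior
  refine tendsto_argmin
    (g := fun k h => weight Θ θ₀ π (ℓ k) (θ₀ + (√(n k : ℝ))⁻¹ • h))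
    (g' := fun h => Real.exp (inner ℝ h s' - 1 / 2 * quad A' h) * π θ₀)
    (C := Real.exp C * B) h2.convex h2.nonneg ha hρ hc ?_ ?_ ?_ ?_
    (fun z => eq_of_shifted_gaussianRisk_le h2 H.posDef_limit s' (hb.trans_le (hbπ _ hθ₀))) ?_
  · exact Eventually.of_forall fun k => (measurable_weight h1 h2 (hℓ k)).comp
      (continuous_const.add (continuous_const_smul _)).measurable
  · exact Eventually.of_forall fun k h => weight_nonneg h2 _ _
  · filter_upwards [hdom] with k hk h
    have := weight_le h2 hB hB0 hk (θ₀ + (√(n k : ℝ))⁻¹ • h)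
    rwa [H.smul_rescale] at this
  · intro h
    have hmem := H.eventually_rescale_mem h1 (tendsto_const_nhds (x := h))
    have hmain : Tendsto (fun k => inner ℝ h (s k) - 1 / 2 * quad (A k) h) atTop
        (𝓝 (inner ℝ h s' - 1 / 2 * quad A' h)) :=
      (tendsto_const_nhds.inner H.score_tendsto).sub
        ((tendsto_quad H.hessian_tendsto tendsto_const_nhds).const_mul _)
    have hdiff : Tendsto (fun k => ℓ k (θ₀ + (√(n k : ℝ))⁻¹ • h) - ℓ k θ₀
        - (inner ℝ h (s k) - 1 / 2 * quad (A k) h)) atTop (𝓝 0) := by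
      rw [Metric.tendsto_nhds]
      intro ε hε
      filter_upwards [hmem, H.expansion ‖h‖ (ε / 2) (half_pos hε)] with k hk hexp
      have := hexp _ hk
      rw [H.smul_rescale] at this
      rw [dist_zero_right, Real.norm_eq_abs]
      linarith [this le_rfl]
    have hexp : Tendsto (fun k => ℓ k (θ₀ + (√(n k : ℝ))⁻¹ • h) - ℓ k θ₀) atTop
        (𝓝 (inner ℝ h s' - 1 / 2 * quad A' h)) := by
      simpa using hdiff.add hmain
    have hπ : Tendsto (fun k => π (θ₀ + (√(n k : ℝ))⁻¹ • h)) atTop (𝓝 (π θ₀)) :=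
      (h2.prior_continuous.continuousAt
        (mem_interior_iff_mem_nhds.1 h1.mem_interior)).tendsto.comp
        (H.tendsto_rescale tendsto_const_nhds)
    refine (((Real.continuous_exp.tendsto _).comp hexp).mul hπ).congr' ?_
    filter_upwards [hmem] with k hk
    rw [weight, Set.indicator_of_mem hk]
    rfl
  · filter_upwards [hdom, H.eventually_rescale_mem h1
      (tendsto_const_nhds (x := xi ρ A' + act A'⁻¹ s'))] with k hk hmem
    have hC : ∀ θ ∈ Θ, ℓ k θ - ℓ k θ₀ ≤ C := fun θ hθ => (hk θ hθ).trans (by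
      have : 0 ≤ c * ‖√(n k : ℝ) • (θ - θ₀)‖ ^ 2 := by positivity
      linarith)
    obtain ⟨κ, hκ, h⟩ := exists_risk_eq h1 h2 (hℓ k) hC (H.size_pos k)
    have h3 := h (θ₀ + (√(n k : ℝ))⁻¹ • (xi ρ A' + act A'⁻¹ s'))
    rw [H.smul_rescale] at h3
    rw [h, h3]
    exact mul_le_mul_of_nonneg_left (hmin k hmem) hκ.le

/-- Laplace-type estimators along a local sequence, with centering at finite sample size. -/
theorem IsLocalSequence.tendsto_laplace {n : ℕ → ℕ} {ℓ : ℕ → EuclideanSpace ℝ (Fin d) → ℝ}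
    {A : ℕ → Matrix (Fin d) (Fin d) ℝ} {s : ℕ → EuclideanSpace ℝ (Fin d)}
    {A' : Matrix (Fin d) (Fin d) ℝ} {s' : EuclideanSpace ℝ (Fin d)}
    (H : IsLocalSequence Θ θ₀ n ℓ A s A' s') (h1 : ParameterAssumption Θ θ₀)
    (h2 : PenaltyAssumption Θ ρ π) (hℓ : ∀ k, Measurable fun θ : Θ => ℓ k θ)
    {θhat : ℕ → EuclideanSpace ℝ (Fin d)}
    (hmin : ∀ k, IsMinOn (risk Θ ρ π (ℓ k) (n k)) Θ (θhat k)) :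
    Tendsto (fun k => √(n k : ℝ) • (θhat k - θ₀) - (xi ρ (A k) + act (A k)⁻¹ (s k))) atTop
      (𝓝 0) := by
  obtain ⟨c, hc, hpd⟩ := H.posDef
  have h := (H.tendsto_minimizer h1 h2 hℓ hmin).sub
    ((tendsto_xi h2 H.posDef_hessian H.posDef_limit hc hpd H.hessian_tendsto).add
      H.tendsto_center)
  simpa using h

end LocalRisk

/-! ### Tightness and a Slutsky lemma for maps which need not be measurable -/

section Slutsky

variable {d : ℕ} {Ω : Type*} [MeasurableSpace Ω] {P : Measure Ω} [IsProbabilityMeasure P]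

theorem exists_norm_bound_of_tendstoInDistribution
    {Y : ℕ → Ω → EuclideanSpace ℝ (Fin d)} {ν : Measure (EuclideanSpace ℝ (Fin d))}
    [IsProbabilityMeasure ν] (hY : TendstoInDistribution Y atTop
      (id : EuclideanSpace ℝ (Fin d) → EuclideanSpace ℝ (Fin d)) (fun _ => P) ν)
    {α : ℝ} (hα : 0 < α) :
    ∃ B : ℝ, 0 ≤ B ∧ ∀ᶠ n in atTop, P {ω | B ≤ ‖Y n ω‖} ≤ ENNReal.ofReal α := by
  have hα' : 0 < ENNReal.ofReal (α / 2) := ENNReal.ofReal_pos.2 (half_pos hα)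
  obtain ⟨K, hK, hKν⟩ := (isTightMeasureSet_iff_exists_isCompact_measure_compl_le.1
    (isTightMeasureSet_singleton (μ := ν))) _ hα'
  obtain ⟨r, hr⟩ := hK.isBounded.exists_norm_le
  refine ⟨|r| + 1, by positivity, ?_⟩
  have hF : IsClosed {x : EuclideanSpace ℝ (Fin d) | |r| + 1 ≤ ‖x‖} :=
    isClosed_le continuous_const continuous_norm
  have hlimsup := ProbabilityMeasure.limsup_measure_closed_le_of_tendsto hY.tendsto hF
  have hνF : ν {x : EuclideanSpace ℝ (Fin d) | |r| + 1 ≤ ‖x‖} < ENNReal.ofReal α := by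
    refine ((measure_mono ?_).trans (hKν ν rfl)).trans_lt
      ((ENNReal.ofReal_lt_ofReal_iff hα).2 (half_lt_self hα))
    intro x hx hxK
    have h1 := hr x hxK
    have h2 : |r| + 1 ≤ ‖x‖ := hx
    linarith [le_abs_self r]
  have hlt := lt_of_le_of_lt hlimsup (by simpa using hνF)
  filter_upwards [eventually_lt_of_limsup_lt hlt] with n hn
  have hn' : (P.map (Y n)) {x | |r| + 1 ≤ ‖x‖} < ENNReal.ofReal α := hn
  rw [Measure.map_apply_of_aemeasurable (hY.forall_aemeasurable n) hF.measurableSet] at hn'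
  exact hn'.le

theorem abs_outerExpectation_sub_le {T S : Ω → ℝ} {N : Set Ω} {α b F : ℝ} (hS : Measurable S)
    (hSF : ∀ ω, |S ω| ≤ F) (hN : MeasurableSet N)
    (h : ∀ ω, |T ω - S ω| ≤ α + N.indicator (fun _ => b) ω) :
    |outerExpectation P T - ∫ ω, S ω ∂P| ≤ α + b * P.real N := by
  have hSi : Integrable S P :=
    Integrable.of_bound hS.aestronglyMeasurable F (Eventually.of_forall hSF)
  have hNi : Integrable (N.indicator fun _ => b) P := (integrable_const b).indicator hN
  have hei : Integrable (fun ω => α + N.indicator (fun _ => b) ω) P :=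
    (integrable_const α).add hNi
  have he : ∫ ω, (α + N.indicator (fun _ => b) ω) ∂P = α + b * P.real N := by
    rw [integral_add (integrable_const α) hNi, integral_indicator hN]
    simp [mul_comm]
  have hlb : ∀ m ∈ {m : ℝ | ∃ g : Ω → ℝ, Measurable g ∧ Integrable g P ∧ (∀ ω, T ω ≤ g ω) ∧
      m = ∫ ω, g ω ∂P}, ∫ ω, S ω ∂P - (α + b * P.real N) ≤ m := by
    rintro m ⟨g, -, hgi, hg, rfl⟩
    rw [← he, ← integral_sub hSi hei]
    refine integral_mono (hSi.sub hei) hgi fun ω => ?_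
    have := abs_le.1 (h ω)
    have := hg ω
    simp only
    linarith
  have hmem : ∫ ω, S ω ∂P + (α + b * P.real N) ∈ {m : ℝ | ∃ g : Ω → ℝ, Measurable g ∧
      Integrable g P ∧ (∀ ω, T ω ≤ g ω) ∧ m = ∫ ω, g ω ∂P} := by
    refine ⟨fun ω => S ω + (α + N.indicator (fun _ => b) ω),
      hS.add (measurable_const.add (measurable_const.indicator hN)), hSi.add hei, fun ω => ?_, ?_⟩
    · have := abs_le.1 (h ω)
      linarith
    · rw [integral_add hSi hei, he]
  have h1 : outerExpectation P T ≤ ∫ ω, S ω ∂P + (α + b * P.real N) := csInf_le ⟨_, hlb⟩ hmem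
  have h2 : ∫ ω, S ω ∂P - (α + b * P.real N) ≤ outerExpectation P T := le_csInf ⟨_, hmem⟩ hlb
  rw [abs_le]
  constructor <;> linarith

/-- A perturbation which is negligible in outer probability does not affect convergence in
distribution. -/
theorem tendstoInLaw_of_tendstoInMeasure_sub {X Y : ℕ → Ω → EuclideanSpace ℝ (Fin d)}
    {ν : Measure (EuclideanSpace ℝ (Fin d))} [IsProbabilityMeasure ν]
    (hY : TendstoInDistribution Y atTop
      (id : EuclideanSpace ℝ (Fin d) → EuclideanSpace ℝ (Fin d)) (fun _ => P) ν)
    (hYm : ∀ᶠ n in atTop, Measurable (Y n))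
    (hXY : TendstoInMeasure P (fun n ω => X n ω - Y n ω) atTop (fun _ => 0)) :
    TendstoInLaw P X ν := by
  intro f
  have hlim := (tendstoInLaw_iff hY.forall_aemeasurable ν).2 hY f
  have hfY : ∀ n, AEMeasurable (fun ω => f (Y n ω)) P := fun n =>
    f.continuous.measurable.comp_aemeasurable (hY.forall_aemeasurable n)
  simp only [fun n => outerExpectation_eq_integral (C := ‖f‖) (hfY n)
    (fun ω => f.norm_coe_le_norm _)] at hlim
  rw [Metric.tendsto_nhds] at hlim ⊢
  intro ε hε
  set α : ℝ := ε / (4 * (1 + 4 * ‖f‖)) with hαdef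
  have hα : 0 < α := by positivity
  have hαε : α + 2 * ‖f‖ * (2 * α) = ε / 4 := by
    rw [hαdef]; field_simp; ring
  obtain ⟨B, hB0, hB⟩ := exists_norm_bound_of_tendstoInDistribution hY hα
  have huc : UniformContinuousOn f (Metric.closedBall (0 : EuclideanSpace ℝ (Fin d)) (B + 1)) :=
    (isCompact_closedBall _ _).uniformContinuousOn_of_continuous f.continuous.continuousOn
  obtain ⟨η, hη, hηf⟩ := Metric.uniformContinuousOn_iff.1 huc α hα
  have hη' : 0 < min η 1 := lt_min hη one_pos
  have hdiff : ∀ᶠ n in atTop, P {ω | min η 1 ≤ ‖X n ω - Y n ω‖} ≤ ENNReal.ofReal α := by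
    have := (tendstoInMeasure_iff_norm.1 hXY) _ hη'
    simp only [sub_zero] at this
    exact (ENNReal.tendsto_nhds_zero.1 this) _ (ENNReal.ofReal_pos.2 hα)
  filter_upwards [hlim (ε / 2) (half_pos hε), hB, hdiff, hYm] with n h1 h2 h3 h4
  set N : Set Ω := toMeasurable P ({ω | B ≤ ‖Y n ω‖} ∪ {ω | min η 1 ≤ ‖X n ω - Y n ω‖}) with hN
  have hNP : P.real N ≤ 2 * α := by
    refine ENNReal.toReal_le_of_le_ofReal (by positivity) ?_
    rw [hN, measure_toMeasurable, two_mul, ENNReal.ofReal_add hα.le hα.le]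
    exact (measure_union_le _ _).trans (add_le_add h2 h3)
  have hpt : ∀ ω, |f (X n ω) - f (Y n ω)| ≤ α + N.indicator (fun _ => 2 * ‖f‖) ω := by
    intro ω
    by_cases hω : ω ∈ N
    · rw [Set.indicator_of_mem hω]
      have h5 := f.dist_le_two_norm (X n ω) (Y n ω)
      rw [Real.dist_eq] at h5
      linarith
    · rw [Set.indicator_of_notMem hω, add_zero]
      have h5 : ω ∉ {ω | B ≤ ‖Y n ω‖} ∪ {ω | min η 1 ≤ ‖X n ω - Y n ω‖} :=
        fun h => hω (subset_toMeasurable _ _ h)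
      simp only [Set.mem_union, Set.mem_ofPred_eq, not_or, not_le, lt_min_iff] at h5
      have h6 : ‖X n ω‖ ≤ B + 1 := by
        calc ‖X n ω‖ = ‖Y n ω + (X n ω - Y n ω)‖ := by rw [add_sub_cancel]
          _ ≤ ‖Y n ω‖ + ‖X n ω - Y n ω‖ := norm_add_le _ _
          _ ≤ B + 1 := by linarith [h5.1, h5.2.2]
      have h7 := hηf (X n ω) (mem_closedBall_zero_iff.2 h6) (Y n ω)
        (mem_closedBall_zero_iff.2 (by linarith [h5.1])) (by rw [dist_eq_norm]; exact h5.2.1)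
      rw [Real.dist_eq] at h7
      exact h7.le
  have h8 := abs_outerExpectation_sub_le (P := P) (T := fun ω => f (X n ω)) (F := ‖f‖)
    (f.continuous.measurable.comp h4) (fun ω => f.norm_coe_le_norm _)
    (measurableSet_toMeasurable _ _) hpt
  have h9 : 2 * ‖f‖ * P.real N ≤ 2 * ‖f‖ * (2 * α) := by gcongr
  rw [Real.dist_eq] at h1 ⊢
  have h10 := abs_sub_le (outerExpectation P fun ω => f (X n ω)) (∫ ω, f (Y n ω) ∂P)
    (∫ x, f x ∂ν)
  have h11 : |outerExpectation P (fun ω => f (X n ω)) - ∫ ω, f (Y n ω) ∂P|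
      ≤ α + 2 * ‖f‖ * P.real N := h8
  linarith

end Slutsky

/-! ### From nonrandom local sequences to outer probability -/

section Principle

variable {d : ℕ} {Ω : Type*}
  {Θ : Set (EuclideanSpace ℝ (Fin d))} {θ₀ : EuclideanSpace ℝ (Fin d)}
  {L : ℕ → EuclideanSpace ℝ (Fin d) → Ω → ℝ}
  {J V : ℕ → Matrix (Fin d) (Fin d) ℝ} {Δ : ℕ → Ω → EuclideanSpace ℝ (Fin d)}

/-- The normalized score `Δ_n / √n`. -/
noncomputable def score (Δ : ℕ → Ω → EuclideanSpace ℝ (Fin d)) (n : ℕ) (ω : Ω) :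
    EuclideanSpace ℝ (Fin d) :=
  (√(n : ℝ))⁻¹ • Δ n ω

theorem U_eq (J : ℕ → Matrix (Fin d) (Fin d) ℝ) (Δ : ℕ → Ω → EuclideanSpace ℝ (Fin d)) (n : ℕ)
    (ω : Ω) : U J Δ n ω = act (J n)⁻¹ (score Δ n ω) := by
  rw [U, score, act_smul]

theorem remainder_eq {n : ℕ} (hn : 0 < n) (θ : EuclideanSpace ℝ (Fin d)) (ω : Ω) :
    remainder L θ₀ J Δ n θ ω = L n θ ω - L n θ₀ ω
      - (inner ℝ (√(n : ℝ) • (θ - θ₀)) (score Δ n ω)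
        - 1 / 2 * quad (J n) (√(n : ℝ) • (θ - θ₀))) := by
  have hr : √(n : ℝ) ≠ 0 := (Real.sqrt_pos.2 (Nat.cast_pos.2 hn)).ne'
  rw [remainder, score, inner_smul_left, inner_smul_right, quad_smul_vec, quad_smul,
    Real.sq_sqrt (Nat.cast_nonneg n)]
  simp [hr]

theorem norm_sqrt_smul_sq (n : ℕ) (x : EuclideanSpace ℝ (Fin d)) :
    ‖√(n : ℝ) • x‖ ^ 2 = n * ‖x‖ ^ 2 := by
  rw [norm_smul, mul_pow, Real.norm_of_nonneg (Real.sqrt_nonneg _),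
    Real.sq_sqrt (Nat.cast_nonneg n)]

theorem tendsto_zero_of_eventually_le_ofReal {u : ℕ → ℝ≥0∞}
    (h : ∀ α : ℝ, 0 < α → ∀ᶠ n in atTop, u n ≤ ENNReal.ofReal α) : Tendsto u atTop (𝓝 0) := by
  rw [ENNReal.tendsto_nhds_zero]
  intro α hα
  by_cases hαt : α = ⊤
  · simp [hαt]
  · have := h α.toReal (ENNReal.toReal_pos hα.ne' hαt)
    rwa [ENNReal.ofReal_toReal hαt] at this

theorem UniformlyPosDef.exists_norm_act_le {A : ℕ → Matrix (Fin d) (Fin d) ℝ}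
    (hA : UniformlyPosDef A) : ∃ C : ℝ, 0 ≤ C ∧ ∀ n, 0 < n → ∀ x, ‖act (A n) x‖ ≤ C * ‖x‖ := by
  obtain ⟨C, hC⟩ := hA.bounded
  exact ⟨d * d * |C|, by positivity, fun n hn x =>
    norm_act_le (fun i j => (hC n hn i j).trans (le_abs_self C)) x⟩

/-- Deterministic step of the domination: a score bound, identifiability away from `θ₀` and control
of the remainder near `θ₀` bound the criterion by a Gaussian exponent. -/
theorem criterion_le_of_bounds {A : Matrix (Fin d) (Fin d) ℝ} {ℓ : EuclideanSpace ℝ (Fin d) → ℝ}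
    {s : EuclideanSpace ℝ (Fin d)} {n : ℕ} {c₀ B D δ ε ε' M : ℝ} (hn : 0 < n) (hc₀ : 0 < c₀)
    (hpd : ∀ x, c₀ * ‖x‖ ^ 2 ≤ quad A x) (hε' : ε' ≤ c₀ / 4) (hε : 0 < ε)
    (hD : 0 < D) (hs : ‖s‖ ≤ B) {θ : EuclideanSpace ℝ (Fin d)} (hθD : ‖θ - θ₀‖ ≤ D)
    (hfar : δ ≤ ‖θ - θ₀‖ → 1 / (n : ℝ) * (ℓ θ - ℓ θ₀) ≤ -ε)
    (hmid : M / √(n : ℝ) ≤ ‖θ - θ₀‖ → ‖θ - θ₀‖ ≤ δ →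
      |ℓ θ - ℓ θ₀ - (inner ℝ (√(n : ℝ) • (θ - θ₀)) s - 1 / 2 * quad A (√(n : ℝ) • (θ - θ₀)))|
        / (n * ‖θ - θ₀‖ ^ 2) ≤ ε')
    (hnear : ‖θ - θ₀‖ ≤ M / √(n : ℝ) →
      |ℓ θ - ℓ θ₀ - (inner ℝ (√(n : ℝ) • (θ - θ₀)) s - 1 / 2 * quad A (√(n : ℝ) • (θ - θ₀)))|
        ≤ ε') (hM : 0 < M) :
    ℓ θ - ℓ θ₀ ≤ c₀ / 4 + 2 * B ^ 2 / c₀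
      - min (c₀ / 8) (ε / D ^ 2) * ‖√(n : ℝ) • (θ - θ₀)‖ ^ 2 := by
  have hn' : (0 : ℝ) < n := Nat.cast_pos.2 hn
  have hr : 0 < √(n : ℝ) := Real.sqrt_pos.2 hn'
  have hC : 0 ≤ c₀ / 4 + 2 * B ^ 2 / c₀ := by positivity
  set h := √(n : ℝ) • (θ - θ₀) with hh
  have hhn : ‖h‖ ^ 2 = n * ‖θ - θ₀‖ ^ 2 := norm_sqrt_smul_sq n _
  rcases le_total δ ‖θ - θ₀‖ with hδ | hδ
  · have h1 := hfar hδ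
    rw [one_div, inv_mul_le_iff₀ hn'] at h1
    have h2 : min (c₀ / 8) (ε / D ^ 2) * ‖h‖ ^ 2 ≤ ε / D ^ 2 * (n * D ^ 2) := by
      rw [hhn]
      gcongr
      exact min_le_right _ _
    have h3 : ε / D ^ 2 * (n * D ^ 2) = n * ε := by field_simp
    linarith
  · have hR : |ℓ θ - ℓ θ₀ - (inner ℝ h s - 1 / 2 * quad A h)| ≤ c₀ / 4 * ‖h‖ ^ 2 + c₀ / 4 := by
      rcases le_total ‖θ - θ₀‖ (M / √(n : ℝ)) with hle | hge
      · exact (hnear hle).trans (hε'.trans (le_add_of_nonneg_left (by positivity)))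
      · have hpos : 0 < ‖θ - θ₀‖ := (div_pos hM hr).trans_le hge
        have h1 := hmid hge hδ
        rw [div_le_iff₀ (by positivity), ← hhn] at h1
        calc _ ≤ ε' * ‖h‖ ^ 2 := h1
          _ ≤ c₀ / 4 * ‖h‖ ^ 2 := by gcongr
          _ ≤ _ := le_add_of_nonneg_right (by positivity)
    have h1 : inner ℝ h s ≤ c₀ / 8 * ‖h‖ ^ 2 + 2 * B ^ 2 / c₀ := by
      have h2 : inner ℝ h s ≤ ‖h‖ * B :=
        (real_inner_le_norm _ _).trans (mul_le_mul_of_nonneg_left hs (norm_nonneg _))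
      have h3 : c₀ / 8 * ‖h‖ ^ 2 + 2 * B ^ 2 / c₀ - ‖h‖ * B = (c₀ * ‖h‖ - 4 * B) ^ 2 / (8 * c₀) := by
        field_simp
        ring
      have h4 : 0 ≤ (c₀ * ‖h‖ - 4 * B) ^ 2 / (8 * c₀) := by positivity
      linarith
    have h5 : min (c₀ / 8) (ε / D ^ 2) * ‖h‖ ^ 2 ≤ c₀ / 8 * ‖h‖ ^ 2 := by
      gcongr
      exact min_le_left _ _
    linarith [hpd h, (abs_le.1 hR).2]

variable [MeasurableSpace Ω] {P : Measure Ω}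

theorem tendstoInMeasure_zero_of_norm_le {ι : Type*} {l : Filter ι}
    {X Y : ι → Ω → EuclideanSpace ℝ (Fin d)} (hX : TendstoInMeasure P X l (fun _ => 0)) {C : ℝ}
    (hC : 0 ≤ C) (h : ∀ᶠ n in l, ∀ ω, ‖Y n ω‖ ≤ C * ‖X n ω‖) :
    TendstoInMeasure P Y l (fun _ => 0) := by
  rw [tendstoInMeasure_iff_norm] at hX ⊢
  simp only [sub_zero] at hX ⊢
  intro ε hε
  refine tendsto_of_tendsto_of_tendsto_of_le_of_le' tendsto_const_nhds
    (hX (ε / (C + 1)) (by positivity)) (Eventually.of_forall fun _ => zero_le) ?_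
  filter_upwards [h] with n hn
  refine measure_mono fun ω hω => ?_
  have h1 : ε ≤ ‖Y n ω‖ := hω
  have h2 := hn ω
  rw [Set.mem_ofPred_eq, div_le_iff₀ (by positivity)]
  nlinarith [norm_nonneg (X n ω)]

theorem IdentifiabilityAssumption.eventually_compl_le
    (h3 : IdentifiabilityAssumption P Θ θ₀ L) {δ : ℝ} (hδ : 0 < δ) :
    ∃ ε : ℝ, 0 < ε ∧ ∀ α : ℝ, 0 < α → ∀ᶠ n : ℕ in atTop,
      P {ω | ∃ θ ∈ Θ, δ ≤ ‖θ - θ₀‖ ∧ -ε < 1 / (n : ℝ) * (L n θ ω - L n θ₀ ω)}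
        ≤ ENNReal.ofReal α := by
  obtain ⟨ε, hε, h⟩ := h3 δ hδ
  refine ⟨ε, hε, fun α hα => ?_⟩
  have hlt : (1 : ℝ≥0∞) - ENNReal.ofReal α < 1 :=
    ENNReal.sub_lt_self ENNReal.one_ne_top one_ne_zero (ENNReal.ofReal_pos.2 hα).ne'
  rw [← h] at hlt
  filter_upwards [eventually_lt_of_lt_liminf hlt] with n hn
  rw [h, innerProb] at hn
  refine (measure_mono ?_).trans (lt_of_tsub_lt_tsub_left hn).le
  rintro ω ⟨θ, hθ, h1, h2⟩ hmem
  exact absurd (hmem θ hθ h1) (not_le.2 h2)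

variable [IsProbabilityMeasure P]

theorem ExpansionAssumption.score_bound (h4 : ExpansionAssumption P Θ θ₀ L J V Δ) {α : ℝ}
    (hα : 0 < α) :
    ∃ B : ℝ, 0 ≤ B ∧ ∀ᶠ n in atTop, P {ω | B < ‖score Δ n ω‖} ≤ ENNReal.ofReal α := by
  obtain ⟨B, hB0, hB⟩ := exists_norm_bound_of_tendstoInDistribution h4.clt hα
  obtain ⟨c, hc, hpd⟩ := h4.variance.posDef
  obtain ⟨C, hC0, hC⟩ := h4.variance.exists_norm_act_le
  refine ⟨C * √(1 / c) * B, by positivity, ?_⟩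
  filter_upwards [hB, eventually_gt_atTop 0] with n hn hn0
  refine (measure_mono fun ω hω => ?_).trans hn
  by_contra hlt
  have h1 : ‖act (invSqrt (V n)) (score Δ n ω)‖ < B := not_le.1 hlt
  have h2 := norm_le_norm_act_invSqrt (h4.variance.symm n hn0) hc (hpd n hn0) (hC n hn0) hC0
    (score Δ n ω)
  have h3 : C * √(1 / c) * B < ‖score Δ n ω‖ := hω
  have h4 : C * √(1 / c) * ‖act (invSqrt (V n)) (score Δ n ω)‖ ≤ C * √(1 / c) * B := by gcongr
  linarith

/-- The remainder is uniformly negligible over bounded sets of local parameters. -/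
theorem ExpansionAssumption.remainder_negligible (h4 : ExpansionAssumption P Θ θ₀ L J V Δ)
    (K : ℝ) {ε : ℝ} (hε : 0 < ε) :
    Tendsto (fun n : ℕ => P {ω | ∃ θ ∈ Θ, ‖√(n : ℝ) • (θ - θ₀)‖ ≤ K ∧
      ε < |remainder L θ₀ J Δ n θ ω|}) atTop (𝓝 0) := by
  refine tendsto_zero_of_eventually_le_ofReal fun α hα => ?_
  set ε' : ℝ := min (min (ε / (K ^ 2 + 1)) ε) (α / 2) with hε'
  have hε'0 : 0 < ε' := by positivity
  have hεα : ε' ≤ α / 2 := min_le_right _ _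
  have hεε : ε' ≤ ε := (min_le_left _ _).trans (min_le_right _ _)
  have hεK : ε' * (K ^ 2 + 1) ≤ ε := by
    rw [← le_div_iff₀ (by positivity)]
    exact (min_le_left _ _).trans (min_le_left _ _)
  obtain ⟨δ, hδ, M, hM, hfar, hnear⟩ := h4.huber ε' hε'0
  have hnear' := eventually_lt_of_limsup_lt
    (hnear.trans_lt (ENNReal.ofReal_pos.2 (half_pos hα)))
  have hsize : ∀ᶠ n : ℕ in atTop, K / δ ≤ √(n : ℝ) :=
    (Real.tendsto_sqrt_atTop.comp tendsto_natCast_atTop_atTop).eventually_ge_atTop _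
  filter_upwards [eventually_lt_of_limsup_lt hfar, hnear', hsize, eventually_gt_atTop 0] with
    n h1 h2 h3 hn
  have hr : 0 < √(n : ℝ) := Real.sqrt_pos.2 (Nat.cast_pos.2 hn)
  have hsub : {ω | ∃ θ ∈ Θ, ‖√(n : ℝ) • (θ - θ₀)‖ ≤ K ∧ ε < |remainder L θ₀ J Δ n θ ω|} ⊆
      {ω | ∃ θ ∈ Θ, M / √(n : ℝ) ≤ ‖θ - θ₀‖ ∧ ‖θ - θ₀‖ ≤ δ ∧
        ε' < |remainder L θ₀ J Δ n θ ω| / (n * ‖θ - θ₀‖ ^ 2)} ∪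
      {ω | ∃ θ ∈ Θ, ‖θ - θ₀‖ ≤ M / √(n : ℝ) ∧ ε' < |remainder L θ₀ J Δ n θ ω|} := by
    rintro ω ⟨θ, hθ, hK, hR⟩
    have hK' : √(n : ℝ) * ‖θ - θ₀‖ ≤ K := by
      rwa [norm_smul, Real.norm_of_nonneg hr.le] at hK
    rcases le_total ‖θ - θ₀‖ (M / √(n : ℝ)) with hle | hge
    · exact Or.inr ⟨θ, hθ, hle, hεε.trans_lt hR⟩
    · refine Or.inl ⟨θ, hθ, hge, ?_, ?_⟩
      · rw [div_le_iff₀ hδ] at h3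
        refine le_of_mul_le_mul_left (hK'.trans h3) hr
      · have hpos : 0 < ‖θ - θ₀‖ := (div_pos hM hr).trans_le hge
        have hn' : (0 : ℝ) < n := Nat.cast_pos.2 hn
        rw [lt_div_iff₀ (by positivity), ← norm_sqrt_smul_sq]
        refine lt_of_le_of_lt ?_ hR
        have : ‖√(n : ℝ) • (θ - θ₀)‖ ^ 2 ≤ K ^ 2 := by gcongr
        nlinarith
  calc P _ ≤ P _ := measure_mono hsub
    _ ≤ _ := measure_union_le _ _
    _ ≤ ENNReal.ofReal (α / 2) + ENNReal.ofReal (α / 2) :=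
        add_le_add (h1.le.trans (ENNReal.ofReal_le_ofReal hεα)) h2.le
    _ = ENNReal.ofReal α := by
        rw [← ENNReal.ofReal_add (by positivity) (by positivity), add_halves]

/-- With high probability, the score is bounded and the criterion is dominated by a Gaussian
exponent. -/
theorem exists_domination (h1 : ParameterAssumption Θ θ₀)
    (h3 : IdentifiabilityAssumption P Θ θ₀ L) (h4 : ExpansionAssumption P Θ θ₀ L J V Δ) {α : ℝ}
    (hα : 0 < α) : ∃ B C c : ℝ, 0 < c ∧ ∀ᶠ n : ℕ in atTop,
      P {ω | ¬ (‖score Δ n ω‖ ≤ B ∧ ∀ θ ∈ Θ,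
        L n θ ω - L n θ₀ ω ≤ C - c * ‖√(n : ℝ) • (θ - θ₀)‖ ^ 2)} ≤ ENNReal.ofReal α := by
  obtain ⟨c₀, hc₀, hpd⟩ := h4.hessian.posDef
  obtain ⟨r, hr⟩ := h1.isCompact.isBounded.exists_norm_le
  have hD : ∀ θ ∈ Θ, ‖θ - θ₀‖ ≤ |r| + ‖θ₀‖ + 1 := fun θ hθ =>
    (norm_sub_le _ _).trans (by linarith [hr θ hθ, le_abs_self r])
  have hα4 : 0 < α / 4 := by positivity
  set ε' := min (c₀ / 4) (α / 4) with hε'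
  have hε'0 : 0 < ε' := by positivity
  obtain ⟨δ, hδ, M, hM, hmid, hnear⟩ := h4.huber ε' hε'0
  obtain ⟨ε, hε, hfar⟩ := h3.eventually_compl_le hδ
  obtain ⟨B, hB0, hB⟩ := h4.score_bound hα4
  have hnear' := eventually_lt_of_limsup_lt (hnear.trans_lt (ENNReal.ofReal_pos.2 hα4))
  refine ⟨B, c₀ / 4 + 2 * B ^ 2 / c₀, min (c₀ / 8) (ε / (|r| + ‖θ₀‖ + 1) ^ 2), by positivity, ?_⟩
  filter_upwards [hB, hfar _ hα4, eventually_lt_of_limsup_lt hmid, hnear',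
    eventually_gt_atTop 0] with n e1 e2 e3 e4 hn
  set E1 := {ω | B < ‖score Δ n ω‖} with hE1
  set E2 := {ω | ∃ θ ∈ Θ, δ ≤ ‖θ - θ₀‖ ∧ -ε < 1 / (n : ℝ) * (L n θ ω - L n θ₀ ω)} with hE2
  set E3 := {ω | ∃ θ ∈ Θ, M / √(n : ℝ) ≤ ‖θ - θ₀‖ ∧ ‖θ - θ₀‖ ≤ δ ∧
    ε' < |remainder L θ₀ J Δ n θ ω| / (n * ‖θ - θ₀‖ ^ 2)} with hE3
  set E4 := {ω | ∃ θ ∈ Θ, ‖θ - θ₀‖ ≤ M / √(n : ℝ) ∧ ε' < |remainder L θ₀ J Δ n θ ω|} with hE4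
  have hsub : {ω | ¬ (‖score Δ n ω‖ ≤ B ∧ ∀ θ ∈ Θ, L n θ ω - L n θ₀ ω ≤
      c₀ / 4 + 2 * B ^ 2 / c₀ - min (c₀ / 8) (ε / (|r| + ‖θ₀‖ + 1) ^ 2) *
        ‖√(n : ℝ) • (θ - θ₀)‖ ^ 2)} ⊆ E1 ∪ E2 ∪ (E3 ∪ E4) := by
    intro ω hω
    by_contra hnot
    simp only [Set.mem_union, not_or] at hnot
    obtain ⟨⟨n1, n2⟩, n3, n4⟩ := hnot
    have n1' : ‖score Δ n ω‖ ≤ B := not_lt.1 n1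
    refine hω ⟨n1', fun θ hθ => ?_⟩
    refine criterion_le_of_bounds (ℓ := fun θ => L n θ ω) (A := J n) (s := score Δ n ω) hn hc₀
      (hpd n hn) (min_le_left _ _) hε (by positivity) n1' (hD θ hθ) (δ := δ) (ε' := ε') (M := M)
      ?_ ?_ ?_ hM
    · exact fun h => not_lt.1 fun hlt => n2 ⟨θ, hθ, h, hlt⟩
    · rw [← remainder_eq hn]
      exact fun h h' => not_lt.1 fun hlt => n3 ⟨θ, hθ, h, h', hlt⟩
    · rw [← remainder_eq hn]
      exact fun h => not_lt.1 fun hlt => n4 ⟨θ, hθ, h, hlt⟩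
  have e3' : P E3 ≤ ENNReal.ofReal (α / 4) :=
    e3.le.trans (ENNReal.ofReal_le_ofReal (min_le_right _ _))
  calc P _ ≤ P (E1 ∪ E2 ∪ (E3 ∪ E4)) := measure_mono hsub
    _ ≤ P (E1 ∪ E2) + P (E3 ∪ E4) := measure_union_le _ _
    _ ≤ (P E1 + P E2) + (P E3 + P E4) :=
        add_le_add (measure_union_le _ _) (measure_union_le _ _)
    _ ≤ (ENNReal.ofReal (α / 4) + ENNReal.ofReal (α / 4)) +
        (ENNReal.ofReal (α / 4) + ENNReal.ofReal (α / 4)) :=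
        add_le_add (add_le_add e1 e2) (add_le_add e3' e4.le)
    _ = ENNReal.ofReal α := by
        rw [← ENNReal.ofReal_add hα4.le hα4.le, ← ENNReal.ofReal_add (by positivity)
          (by positivity)]
        congr 1; ring

/-- A statistic which tends to zero along all nonrandom local sequences drawn from the sample
tends to zero in outer probability. -/
theorem tendstoInMeasure_of_localSequences (h1 : ParameterAssumption Θ θ₀)
    (h3 : IdentifiabilityAssumption P Θ θ₀ L) (h4 : ExpansionAssumption P Θ θ₀ L J V Δ)
    {T : ℕ → Ω → EuclideanSpace ℝ (Fin d)}
    (hT : ∀ (n : ℕ → ℕ) (ω : ℕ → Ω) (A' : Matrix (Fin d) (Fin d) ℝ)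
      (s' : EuclideanSpace ℝ (Fin d)),
      IsLocalSequence Θ θ₀ n (fun k θ => L (n k) θ (ω k)) (fun k => J (n k))
        (fun k => score Δ (n k) (ω k)) A' s' →
      Tendsto (fun k => T (n k) (ω k)) atTop (𝓝 0)) :
    TendstoInMeasure P T atTop (fun _ => 0) := by
  rw [tendstoInMeasure_iff_norm]
  simp only [sub_zero]
  intro η hη
  refine tendsto_zero_of_eventually_le_ofReal fun α hα => ?_
  obtain ⟨B, C, c, hc, hdom⟩ := exists_domination h1 h3 h4 (half_pos hα)
  have key : ∃ m : ℕ, ∀ n, m + 1 ≤ n → ∀ ω,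
      (‖score Δ n ω‖ ≤ B ∧ ∀ θ ∈ Θ,
        L n θ ω - L n θ₀ ω ≤ C - c * ‖√(n : ℝ) • (θ - θ₀)‖ ^ 2) →
      (∀ θ ∈ Θ, ‖√(n : ℝ) • (θ - θ₀)‖ ≤ m → |remainder L θ₀ J Δ n θ ω| ≤ 1 / ((m : ℝ) + 1)) →
      ‖T n ω‖ < η := by
    by_contra hnot
    push Not at hnot
    choose n hn ω hω hrem hlarge using hnot
    obtain ⟨c₀, hc₀, hpd⟩ := h4.hessian.posDef
    obtain ⟨CJ, hCJ⟩ := h4.hessian.bounded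
    have hpos : ∀ k, 0 < n k := fun k => (Nat.succ_pos k).trans_le (hn k)
    have hcompact : IsCompact ((Set.univ.pi fun _ : Fin d => Set.univ.pi fun _ : Fin d =>
        Set.Icc (-CJ) CJ) ×ˢ Metric.closedBall (0 : EuclideanSpace ℝ (Fin d)) B) :=
      (isCompact_univ_pi fun _ => isCompact_univ_pi fun _ => isCompact_Icc).prod
        (isCompact_closedBall _ _)
    obtain ⟨⟨A', s'⟩, -, φ, hφ, hlim⟩ := hcompact.tendsto_subseq
      (X := (Fin d → Fin d → ℝ) × EuclideanSpace ℝ (Fin d))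
      (x := fun k => ((J (n k) : Fin d → Fin d → ℝ), score Δ (n k) (ω k)))
      (fun k => ⟨fun i _ j _ => abs_le.1 (hCJ _ (hpos k) i j),
        mem_closedBall_zero_iff.2 (hω k).1⟩)
    have hnt : Tendsto n atTop atTop :=
      tendsto_atTop_mono (fun k => (Nat.le_succ k).trans (hn k)) tendsto_id
    have hloc : IsLocalSequence Θ θ₀ (n ∘ φ) (fun k θ => L (n (φ k)) θ (ω (φ k)))
        (fun k => J (n (φ k))) (fun k => score Δ (n (φ k)) (ω (φ k))) A' s' := by
      refine ⟨hnt.comp hφ.tendsto_atTop, fun k => hpos _, fun k => h4.hessian.symm _ (hpos _),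
        ⟨c₀, hc₀, fun k => hpd _ (hpos _)⟩, (continuous_fst.tendsto _).comp hlim,
        (continuous_snd.tendsto _).comp hlim, fun K ε hε => ?_,
        ⟨C, c, hc, Eventually.of_forall fun k => (hω (φ k)).2⟩⟩
      have hK : ∀ᶠ k in atTop, K ≤ (φ k : ℝ) :=
        (tendsto_natCast_atTop_atTop.comp hφ.tendsto_atTop).eventually_ge_atTop K
      have hsmall : ∀ᶠ k in atTop, 1 / ((φ k : ℝ) + 1) < ε :=
        (tendsto_one_div_add_atTop_nhds_zero_nat.comp hφ.tendsto_atTop).eventually_lt_const hε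
      filter_upwards [hK, hsmall] with k h5 h6 θ hθ hθK
      rw [Function.comp_apply] at hθK ⊢
      rw [← remainder_eq (hpos (φ k))]
      exact (hrem (φ k) θ hθ (hθK.trans h5)).trans h6.le
    have hT0 := (hT _ (ω ∘ φ) A' s' hloc).norm
    rw [norm_zero] at hT0
    obtain ⟨k, hk⟩ := (hT0.eventually_lt_const hη).exists
    exact absurd (hlarge (φ k)) (not_le.2 hk)
  obtain ⟨m, hm⟩ := key
  have hrem := ENNReal.tendsto_nhds_zero.1 (h4.remainder_negligible (m : ℝ)
    (ε := 1 / ((m : ℝ) + 1)) (by positivity)) _ (ENNReal.ofReal_pos.2 (half_pos hα))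
  filter_upwards [hdom, hrem, eventually_ge_atTop (m + 1)] with n e1 e2 hn
  calc P {ω | η ≤ ‖T n ω‖}
      ≤ P ({ω | ¬ (‖score Δ n ω‖ ≤ B ∧ ∀ θ ∈ Θ,
          L n θ ω - L n θ₀ ω ≤ C - c * ‖√(n : ℝ) • (θ - θ₀)‖ ^ 2)} ∪
        {ω | ∃ θ ∈ Θ, ‖√(n : ℝ) • (θ - θ₀)‖ ≤ m ∧
          1 / ((m : ℝ) + 1) < |remainder L θ₀ J Δ n θ ω|}) := by
        refine measure_mono fun ω hω => ?_
        by_contra hnot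
        simp only [Set.mem_union, not_or] at hnot
        refine absurd (hm n hn ω (not_not.1 hnot.1) fun θ hθ hθm => ?_) (not_lt.2 hω)
        exact not_lt.1 fun hlt => hnot.2 ⟨θ, hθ, hθm, hlt⟩
    _ ≤ _ := measure_union_le _ _
    _ ≤ ENNReal.ofReal (α / 2) + ENNReal.ofReal (α / 2) := add_le_add e1 e2
    _ = ENNReal.ofReal α := by
        rw [← ENNReal.ofReal_add (by positivity) (by positivity), add_halves]

end Principle

end LTE

theorem theorem2 {d : ℕ} {Ω : Type*} [MeasurableSpace Ω] (P : MeasureTheory.Measure Ω)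
    [MeasureTheory.IsProbabilityMeasure P]
    (Θ : Set (EuclideanSpace ℝ (Fin d))) (θ₀ : EuclideanSpace ℝ (Fin d))
    (ρ π : EuclideanSpace ℝ (Fin d) → ℝ)
    (L : ℕ → EuclideanSpace ℝ (Fin d) → Ω → ℝ)
    (J V : ℕ → Matrix (Fin d) (Fin d) ℝ) (Δ : ℕ → Ω → EuclideanSpace ℝ (Fin d))
    (θhat : ℕ → Ω → EuclideanSpace ℝ (Fin d))
    (hL : LTE.MeasurableCriterion Θ L)
    (h1 : LTE.ParameterAssumption Θ θ₀)
    (h2 : LTE.PenaltyAssumption Θ ρ π)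
    (h3 : LTE.IdentifiabilityAssumption P Θ θ₀ L)
    (h4 : LTE.ExpansionAssumption P Θ θ₀ L J V Δ)
    (hθ : LTE.IsLTE Θ ρ π L θhat) :
    -- `√n (θ̂ - θ₀) = ξ_{J_n} + U_n + o_p(1)`
    TendstoInMeasure P
      (fun (n : ℕ) ω => √(n : ℝ) • (θhat n ω - θ₀) - (LTE.xi ρ (J n) + LTE.U J Δ n ω)) atTop
      (fun _ => 0) ∧
    -- `V_n^{-1/2} J_n U_n → N(0, I)` in distribution
    TendstoInDistribution
      (fun n ω => LTE.act (LTE.invSqrt (V n) * J n) (LTE.U J Δ n ω)) atTop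
      (id : EuclideanSpace ℝ (Fin d) → EuclideanSpace ℝ (Fin d)) (fun _ => P)
      (stdGaussian (EuclideanSpace ℝ (Fin d))) ∧
    -- `V_n^{-1/2} J_n (√n (θ̂ - θ₀) - ξ_{J_n}) → N(0, I)` in distribution
    LTE.TendstoInLaw P
      (fun n ω => LTE.act (LTE.invSqrt (V n) * J n)
        (√(n : ℝ) • (θhat n ω - θ₀) - LTE.xi ρ (J n)))
      (stdGaussian (EuclideanSpace ℝ (Fin d))) ∧
    -- symmetric loss: `ξ_{J_n} = 0`, and asymptotic equivalence to extremum estimators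
    ((∀ n, 0 < n → ∀ h, LTE.scaledLoss ρ n h = LTE.scaledLoss ρ n (-h)) →
      (∀ n, 0 < n → LTE.xi ρ (J n) = 0) ∧
      ∀ θex : ℕ → Ω → EuclideanSpace ℝ (Fin d), LTE.IsExtremumEstimator Θ L θex →
        TendstoInMeasure P (fun (n : ℕ) ω => √(n : ℝ) • (θhat n ω - θex n ω)) atTop (fun _ => 0)) := by
  obtain ⟨cJ, hcJ, hJpd⟩ := h4.hessian.posDef
  have hJ : ∀ n, 0 < n → (J n).PosDef := fun n hn =>
    LTE.posDef_of_quad (h4.hessian.symm n hn) hcJ (hJpd n hn)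
  have hexpand : TendstoInMeasure P
      (fun (n : ℕ) ω => √(n : ℝ) • (θhat n ω - θ₀) - (LTE.xi ρ (J n) + LTE.U J Δ n ω)) atTop
      (fun _ => 0) := by
    refine LTE.tendstoInMeasure_of_localSequences h1 h3 h4 fun n ω A' s' H => ?_
    simp only [LTE.U_eq]
    exact H.tendsto_laplace h1 h2 (fun k => hL.measurable_param _ (H.size_pos k) _)
      fun k => (hθ _ (H.size_pos k) _).2
  have hscore : ∀ n ω, LTE.act (LTE.invSqrt (V n) * J n) (LTE.U J Δ n ω)
      = LTE.act (LTE.invSqrt (V n)) ((√(n : ℝ))⁻¹ • Δ n ω) := by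
    intro n ω
    rcases Nat.eq_zero_or_pos n with rfl | hn
    · simp [LTE.U, LTE.act]
    · rw [LTE.U_eq, LTE.act_mul, LTE.act_act_inv (hJ n hn), LTE.score]
  have hclt : TendstoInDistribution
      (fun n ω => LTE.act (LTE.invSqrt (V n) * J n) (LTE.U J Δ n ω)) atTop
      (id : EuclideanSpace ℝ (Fin d) → EuclideanSpace ℝ (Fin d)) (fun _ => P)
      (stdGaussian (EuclideanSpace ℝ (Fin d))) := by
    simp only [hscore]
    exact h4.clt
  refine ⟨hexpand, hclt, LTE.tendstoInLaw_of_tendstoInMeasure_sub hclt ?_ ?_, fun hsymm => ⟨?_, ?_⟩⟩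
  · filter_upwards [eventually_gt_atTop 0] with n hn
    simp only [hscore]
    exact (LTE.continuous_act _).measurable.comp
      ((measurable_const_smul (√(n : ℝ))⁻¹).comp (h4.measurable_score n hn))
  · obtain ⟨cV, hcV, hVpd⟩ := h4.variance.posDef
    obtain ⟨C, hC0, hC⟩ := h4.hessian.exists_norm_act_le
    refine LTE.tendstoInMeasure_zero_of_norm_le hexpand (C := √(1 / cV) * C) (by positivity) ?_
    filter_upwards [eventually_gt_atTop 0] with n hn ω
    rw [← LTE.act_sub, sub_sub, LTE.act_mul, mul_assoc]
    exact (LTE.norm_act_invSqrt_le (h4.variance.symm n hn) hcV (hVpd n hn) _).trans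
      (mul_le_mul_of_nonneg_left (hC n hn _) (Real.sqrt_nonneg _))
  all_goals
    have hρ : ∀ h, ρ h = ρ (-h) := by
      intro h
      simpa [LTE.scaledLoss] using hsymm 1 one_pos h
  · exact fun n hn => LTE.xi_eq_zero_of_even h2 hρ (hJ n hn)
  · intro θex hex
    refine LTE.tendstoInMeasure_of_localSequences h1 h3 h4 fun n ω A' s' H => ?_
    have hl := H.tendsto_laplace h1 h2 (fun k => hL.measurable_param _ (H.size_pos k) _)
      (θhat := fun k => θhat (n k) (ω k)) fun k => (hθ _ (H.size_pos k) _).2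
    have he := H.tendsto_extremum h1 (θex := fun k => θex (n k) (ω k))
      (fun k => (hex _ (H.size_pos k) _).1) fun k => (hex _ (H.size_pos k) _).2
    refine (by simpa using hl.sub he : Tendsto _ _ _).congr fun k => ?_
    rw [LTE.xi_eq_zero_of_even h2 hρ (H.posDef_hessian k)]
    simp only [smul_sub]
    abel
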